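/- Let $k$ be a commutative ring and $q\in k^{\times}$ (for instance $k=\mathbb{Z}[q,q^{-1}]$ or a field of rational functions, with $q$ an indeterminate). The oriented Temperley–Lieb category $\mathcal{TLO}(q)$ is the strict monoidal $k$-linear category presented by two generating objects $\vee,\wedge$ (so that objects are words on $\{\vee,\wedge\}$), four generating arrows $$cap_+:\vee\wedge\to\varnothing,\quad cap_-:\wedge\vee\to\varnothing,\quad cup_+:\varnothing\to\vee\wedge,\quad cup_-:\varnothing\to\wedge\vee,$$ and the relations obtained by reading the following rules as equalities: $$(cap_-\otimes 1_\wedge)\circ(1_\wedge\otimes cup_+)\to 1_\wedge,\qquad (1_\wedge\otimes cap_+)\circ(cup_-\otimes 1_\wedge)\to 1_\wedge,$$ $$(cap_+\otimes 1_\vee)\circ(1_\vee\otimes cup_-)\to 1_\vee,\qquad (1_\vee\otimes cap_-)\circ(cup_+\otimes 1_\vee)\to 1_\vee,$$ $$cap_+\circ cup_+\to q\,1_\varnothing,\qquad cap_-\circ cup_-\to q^{-1}\,1_\varnothing .$$ A diagram $v\to w$ is an arrow of the free strict monoidal category on these generators, i.e. a formal composite of tensor products of generators and identities, modulo the strict monoidal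 category laws, including the exchange relation $(f'\otimes g')\circ(f\otimes g)=(f'\circ f)\otimes(g'\circ g)$. For a diagram $D$ we write $D\to c\,D'$ if some formal arrow representing $D$ becomes, by one application of a rule $l\to c\,r$ to a sub-expression (replacing $l$ by $r$), a formal arrow representing $D'$; a diagram from which no such step starts is said to be in normal form. On finite $k$-linear combinations of diagrams $v\to w$ the rewriting steps are $aD+z\to ac\,D'+z$, where $D\to c\,D'$, $a\in k\setminus\{0\}$ and $D$ does not occur in $z$. Theorem. (1) For all words $v,w$ on $\{\vee,\wedge\}$, this rewriting system modulo the exchange relation on linear combinations of diagrams $v\to w$ is convergent: there is no infinite rewriting sequence, and whenever $x$ rewrites in finitely many (possibly zero) steps as $y$ and as $y'$, then $y$ and $y'$ rewrite in finitely many (possibly zero) steps as a common element. (2) For all words $v,w$ on $\{\vee,\wedge\}$, the classes of the diagrams $v\to w$ in normal form are a basis of the $k$-module $\mathrm{Hom}_{\mathcal{TLO}(q)}(v,w)$, indexed by these diagrams. -/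

import Mathlib

open CategoryTheory

/-! ### Abstract rewriting systems -/

namespace ARS

variable {A : Type*}

/-- `r` is terminating: every rewriting sequence is finite. -/
def Terminating (r : A → A → Prop) : Prop :=
  ∀ s : ℕ → A, ¬ ∀ n, r (s n) (s (n + 1))

/-- `r` is confluent: if `a` rewrites (in finitely many steps, possibly none) as `b` and as `c`,
then `b` and `c` rewrite as a common element. -/
def Confluent (r : A → A → Prop) : Prop :=
  ∀ a b c, Relation.ReflTransGen r a b → Relation.ReflTransGen r a c →
    ∃ d, Relation.ReflTransGen r b d ∧ Relation.ReflTransGen r c d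

/-- `r` is convergent: terminating and confluent. -/
def Convergent (r : A → A → Prop) : Prop :=
  Terminating r ∧ Confluent r

end ARS

/-! ### Formal arrows and diagrams -/

namespace StrictMon

variable {S : Type} {F : List S → List S → Type}

/-- Formal arrows on generating objects `S` and generating arrows `F`: alternating compositions
and tensor products of generators and identities. Objects are words on `S`. The composition is
written in diagrammatic order: `comp f g` is `g ∘ f`. -/
inductive Arrow (F : List S → List S → Type) : List S → List S → Type
  | gen {v w : List S} (g : F v w) : Arrow F v w
  | id (v : List S) : Arrow F v v
  | comp {u v w : List S} (f : Arrow F u v) (g : Arrow F v w) : Arrow F u w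
  | tensor {v w v' w' : List S} (f : Arrow F v w) (g : Arrow F v' w') :
      Arrow F (v ++ v') (w ++ w')

/-- The congruence on formal arrows generated by the laws of a strict monoidal category: category
laws, strict associativity and unitality of the tensor product, and the exchange relation
`(f ⊗ g) ≫ (f' ⊗ g') = (f ≫ f') ⊗ (g ≫ g')`. It is heterogeneous only because, for instance,
`(u ++ v) ++ w` and `u ++ (v ++ w)` are equal words, but not syntactically so. -/
inductive ArrowEquiv : ∀ {v w v' w' : List S}, Arrow F v w → Arrow F v' w' → Prop
  | refl {v w : List S} (f : Arrow F v w) : ArrowEquiv f f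
  | symm {v w v' w' : List S} {f : Arrow F v w} {g : Arrow F v' w'} : ArrowEquiv f g → ArrowEquiv g f
  | trans {v w v' w' v'' w'' : List S} {f : Arrow F v w} {g : Arrow F v' w'}
      {h : Arrow F v'' w''} : ArrowEquiv f g → ArrowEquiv g h → ArrowEquiv f h
  | comp_congr {u v w u' v' w' : List S} {f : Arrow F u v} {g : Arrow F v w}
      {f' : Arrow F u' v'} {g' : Arrow F v' w'} :
      ArrowEquiv f f' → ArrowEquiv g g' → ArrowEquiv (f.comp g) (f'.comp g')
  | tensor_congr {v w x y v' w' x' y' : List S} {f : Arrow F v w} {g : Arrow F x y}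
      {f' : Arrow F v' w'} {g' : Arrow F x' y'} :
      ArrowEquiv f f' → ArrowEquiv g g' → ArrowEquiv (f.tensor g) (f'.tensor g')
  | id_comp {v w : List S} (f : Arrow F v w) : ArrowEquiv ((Arrow.id v).comp f) f
  | comp_id {v w : List S} (f : Arrow F v w) : ArrowEquiv (f.comp (Arrow.id w)) f
  | assoc {u v w x : List S} (f : Arrow F u v) (g : Arrow F v w) (h : Arrow F w x) :
      ArrowEquiv ((f.comp g).comp h) (f.comp (g.comp h))
  | id_tensor {v w : List S} (f : Arrow F v w) : ArrowEquiv ((Arrow.id []).tensor f) f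
  | tensor_id {v w : List S} (f : Arrow F v w) : ArrowEquiv (f.tensor (Arrow.id [])) f
  | tensor_assoc {v w v' w' v'' w'' : List S} (f : Arrow F v w) (g : Arrow F v' w')
      (h : Arrow F v'' w'') : ArrowEquiv ((f.tensor g).tensor h) (f.tensor (g.tensor h))
  | id_tensor_id (v w : List S) :
      ArrowEquiv ((Arrow.id v).tensor (Arrow.id w)) (Arrow.id (v ++ w))
  | exchange {u v w u' v' w' : List S} (f : Arrow F u v) (f' : Arrow F v w)
      (g : Arrow F u' v') (g' : Arrow F v' w') :
      ArrowEquiv ((f.tensor g).comp (f'.tensor g')) ((f.comp f').tensor (g.comp g'))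

/-- The equivalence relation on formal arrows with given source and target. -/
def setoid (F : List S → List S → Type) (v w : List S) : Setoid (Arrow F v w) where
  r f g := ArrowEquiv f g
  iseqv := ⟨ArrowEquiv.refl, ArrowEquiv.symm, ArrowEquiv.trans⟩

/-- A diagram `v → w`: an arrow of the free strict monoidal category on `(S, F)`, that is, a
formal arrow modulo the laws of strict monoidal categories, the exchange relation included. -/
def Diagram (F : List S → List S → Type) (v w : List S) : Type :=
  Quotient (setoid F v w)

namespace Diagram

/-- The diagram of a formal arrow. -/
def mk {v w : List S} (f : Arrow F v w) : Diagram F v w :=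
  Quotient.mk (setoid F v w) f

/-- Identity diagram. -/
def id (F : List S → List S → Type) (v : List S) : Diagram F v v :=
  mk (Arrow.id v)

/-- Composition of diagrams, in diagrammatic order. -/
def comp {u v w : List S} : Diagram F u v → Diagram F v w → Diagram F u w :=
  Quotient.map₂ Arrow.comp fun _ _ h _ _ h' => ArrowEquiv.comp_congr h h'

/-- Tensor product (juxtaposition) of diagrams. -/
def tensor {v w v' w' : List S} :
    Diagram F v w → Diagram F v' w' → Diagram F (v ++ v') (w ++ w') :=
  Quotient.map₂ Arrow.tensor fun _ _ h _ _ h' => ArrowEquiv.tensor_congr h h'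

theorem mk_heq {v w v' w' : List S} {f : Arrow F v w} {g : Arrow F v' w'}
    (hv : v = v') (hw : w = w') (h : ArrowEquiv f g) : HEq (mk f) (mk g) := by
  subst hv hw
  exact heq_of_eq (Quotient.sound h)

theorem id_comp {v w : List S} (f : Diagram F v w) : (id F v).comp f = f := by
  induction f using Quotient.inductionOn with
  | h f => exact Quotient.sound (ArrowEquiv.id_comp f)

theorem comp_id {v w : List S} (f : Diagram F v w) : f.comp (id F w) = f := by
  induction f using Quotient.inductionOn with
  | h f => exact Quotient.sound (ArrowEquiv.comp_id f)

theorem assoc {u v w x : List S} (f : Diagram F u v) (g : Diagram F v w) (h : Diagram F w x) :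
    (f.comp g).comp h = f.comp (g.comp h) := by
  induction f, g, h using Quotient.inductionOn₃ with
  | h f g h => exact Quotient.sound (ArrowEquiv.assoc f g h)

theorem id_tensor_id (v w : List S) : (id F v).tensor (id F w) = id F (v ++ w) :=
  Quotient.sound (ArrowEquiv.id_tensor_id v w)

theorem exchange {u v w u' v' w' : List S} (f : Diagram F u v) (f' : Diagram F v w)
    (g : Diagram F u' v') (g' : Diagram F v' w') :
    (f.tensor g).comp (f'.tensor g') = (f.comp f').tensor (g.comp g') := by
  induction f, g using Quotient.inductionOn₂ with
  | h f g =>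
    induction f', g' using Quotient.inductionOn₂ with
    | h f' g' => exact Quotient.sound (ArrowEquiv.exchange f f' g g')

theorem id_tensor {v w : List S} (f : Diagram F v w) : (id F []).tensor f = f := by
  induction f using Quotient.inductionOn with
  | h f => exact Quotient.sound (ArrowEquiv.id_tensor f)

theorem tensor_id {v w : List S} (f : Diagram F v w) : HEq (f.tensor (id F [])) f := by
  induction f using Quotient.inductionOn with
  | h f => exact mk_heq (by simp) (by simp) (ArrowEquiv.tensor_id f)

theorem tensor_assoc {v w v' w' v'' w'' : List S} (f : Diagram F v w) (g : Diagram F v' w')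
    (h : Diagram F v'' w'') : HEq ((f.tensor g).tensor h) (f.tensor (g.tensor h)) := by
  induction f, g, h using Quotient.inductionOn₃ with
  | h f g h => exact mk_heq (by simp) (by simp) (ArrowEquiv.tensor_assoc f g h)

end Diagram

/-! ### Rewriting of linear combinations of diagrams, modulo the exchange relation -/

section Rewriting

variable {k : Type*}

/-- A family of rules `l → c • r`, with `l` and `r` parallel formal arrows and `c` a scalar. The
same family, read as relations `l = c • r`, serves for presentations. -/
abbrev Rules (k : Type*) (F : List S → List S → Type) :=
  ∀ ⦃v w : List S⦄, Arrow F v w → k → Arrow F v w → Prop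

/-- Application of one rule inside a formal arrow: `ArrowStep R f c f'` says that one occurrence
of the left-hand side `l` of a rule `l → c • r` in `f` is replaced by `r`, which gives `f'`. -/
inductive ArrowStep (R : Rules k F) : ∀ {v w : List S}, Arrow F v w → k → Arrow F v w → Prop
  | rule {v w : List S} {l : Arrow F v w} {c : k} {r : Arrow F v w} (h : R l c r) :
      ArrowStep R l c r
  | comp_right {u v w : List S} {f f' : Arrow F u v} {c : k} (g : Arrow F v w) :
      ArrowStep R f c f' → ArrowStep R (f.comp g) c (f'.comp g)
  | comp_left {u v w : List S} (f : Arrow F u v) {g g' : Arrow F v w} {c : k} :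
      ArrowStep R g c g' → ArrowStep R (f.comp g) c (f.comp g')
  | tensor_right {v w v' w' : List S} {f f' : Arrow F v w} {c : k} (g : Arrow F v' w') :
      ArrowStep R f c f' → ArrowStep R (f.tensor g) c (f'.tensor g)
  | tensor_left {v w v' w' : List S} (f : Arrow F v w) {g g' : Arrow F v' w'} {c : k} :
      ArrowStep R g c g' → ArrowStep R (f.tensor g) c (f.tensor g')

/-- A rewriting step `D → c • D'` modulo the exchange relation: the laws of strict monoidal
categories may be used, in both directions, before and after the application of a rule. -/
def DiagramStep (R : Rules k F) {v w : List S} (D : Diagram F v w) (c : k)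
    (D' : Diagram F v w) : Prop :=
  ∃ f f' : Arrow F v w, Diagram.mk f = D ∧ Diagram.mk f' = D' ∧ ArrowStep R f c f'

/-- A diagram is in normal form if no rewriting step starts from it. -/
def IsNormalForm (R : Rules k F) {v w : List S} (D : Diagram F v w) : Prop :=
  ∀ (c : k) (D' : Diagram F v w), ¬ DiagramStep R D c D'

/-- Rewriting steps on linear combinations of diagrams: a diagram `D` that occurs with a nonzero
coefficient `a` is rewritten, `a • D + z → a • c • D' + z`, where `D` does not occur in `z`. -/
def LinearStep [CommRing k] (R : Rules k F) (v w : List S) (x y : Diagram F v w →₀ k) : Prop :=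
  ∃ (D D' : Diagram F v w) (c a : k) (z : Diagram F v w →₀ k),
    DiagramStep R D c D' ∧ a ≠ 0 ∧ z D = 0 ∧
      x = Finsupp.single D a + z ∧ y = Finsupp.single D' (a * c) + z

theorem DiagramStep.comp_right {R : Rules k F} {u v w : List S} {D D' : Diagram F u v} {c : k}
    (h : DiagramStep R D c D') (E : Diagram F v w) :
    DiagramStep R (D.comp E) c (D'.comp E) := by
  obtain ⟨f, f', rfl, rfl, h⟩ := h
  induction E using Quotient.inductionOn with
  | h g => exact ⟨_, _, rfl, rfl, h.comp_right g⟩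

theorem DiagramStep.comp_left {R : Rules k F} {u v w : List S} {D D' : Diagram F v w} {c : k}
    (E : Diagram F u v) (h : DiagramStep R D c D') :
    DiagramStep R (E.comp D) c (E.comp D') := by
  obtain ⟨f, f', rfl, rfl, h⟩ := h
  induction E using Quotient.inductionOn with
  | h g => exact ⟨_, _, rfl, rfl, h.comp_left g⟩

theorem DiagramStep.tensor_right {R : Rules k F} {v w v' w' : List S} {D D' : Diagram F v w}
    {c : k} (h : DiagramStep R D c D') (E : Diagram F v' w') :
    DiagramStep R (D.tensor E) c (D'.tensor E) := by
  obtain ⟨f, f', rfl, rfl, h⟩ := h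
  induction E using Quotient.inductionOn with
  | h g => exact ⟨_, _, rfl, rfl, h.tensor_right g⟩

theorem DiagramStep.tensor_left {R : Rules k F} {v w v' w' : List S} {D D' : Diagram F v' w'}
    {c : k} (E : Diagram F v w) (h : DiagramStep R D c D') :
    DiagramStep R (E.tensor D) c (E.tensor D') := by
  obtain ⟨f, f', rfl, rfl, h⟩ := h
  induction E using Quotient.inductionOn with
  | h g => exact ⟨_, _, rfl, rfl, h.tensor_left g⟩

end Rewriting

/-! ### Presented strict monoidal linear categories -/

section Presented

variable {k : Type*} [CommRing k]

/-- Bilinear extension of a binary operation to finite linear combinations. -/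
noncomputable def bilin (k : Type*) [CommRing k] {A B C : Type*} (op : A → B → C) :
    (A →₀ k) →ₗ[k] (B →₀ k) →ₗ[k] (C →₀ k) :=
  Finsupp.linearCombination k fun a => Finsupp.lmapDomain k k (op a)

theorem bilin_single {A B C : Type*} (op : A → B → C) (a : A) (b : B) (x y : k) :
    bilin k op (Finsupp.single a x) (Finsupp.single b y) = Finsupp.single (op a b) (x * y) := by
  simp [bilin]

/-- The relations `l = c • r` in all contexts, spanned linearly: the ideal (for `∘` and `⊗`) of
the free linear category that the relations generate. -/
noncomputable def relationIdeal (R : Rules k F) (v w : List S) : Submodule k (Diagram F v w →₀ k) :=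
  Submodule.span k {x | ∃ (D D' : Diagram F v w) (c : k),
    DiagramStep R D c D' ∧ x = Finsupp.single D 1 - Finsupp.single D' c}

/-- The space `Hom(v, w)` of the strict monoidal linear category presented by `(S, F, R)`. -/
def LinHom (R : Rules k F) (v w : List S) : Type _ :=
  (Diagram F v w →₀ k) ⧸ relationIdeal R v w

noncomputable instance (R : Rules k F) (v w : List S) : AddCommGroup (LinHom R v w) :=
  inferInstanceAs (AddCommGroup ((Diagram F v w →₀ k) ⧸ relationIdeal R v w))

noncomputable instance (R : Rules k F) (v w : List S) : Module k (LinHom R v w) :=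
  inferInstanceAs (Module k ((Diagram F v w →₀ k) ⧸ relationIdeal R v w))

theorem bilin_mem_right {S' : Type} {G : List S' → List S' → Type} {R : Rules k F}
    {R' : Rules k G} {v w : List S} {v' w' : List S'} {B : Type*}
    (op : Diagram F v w → B → Diagram G v' w')
    (hop : ∀ D c D' E, DiagramStep R D c D' → DiagramStep R' (op D E) c (op D' E))
    {x : Diagram F v w →₀ k} (hx : x ∈ relationIdeal R v w) (y : B →₀ k) :
    bilin k op x y ∈ relationIdeal R' v' w' := by
  induction hx using Submodule.span_induction with
  | mem x hx =>
    obtain ⟨D, D', c, h, rfl⟩ := hx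
    induction y using Finsupp.induction_linear with
    | zero => simp
    | add y y' hy hy' => rw [map_add]; exact add_mem hy hy'
    | single E e =>
      have := (relationIdeal R' v' w').smul_mem e
        (Submodule.subset_span ⟨_, _, c, hop D c D' E h, rfl⟩)
      simpa [bilin_single, smul_sub, mul_comm] using this
  | zero => simp
  | add x x' _ _ hx hx' => rw [map_add, LinearMap.add_apply]; exact add_mem hx hx'
  | smul a x _ hx => rw [map_smul, LinearMap.smul_apply]; exact Submodule.smul_mem _ a hx

theorem bilin_mem_left {S' : Type} {G : List S' → List S' → Type} {R : Rules k F}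
    {R' : Rules k G} {v w : List S} {v' w' : List S'} {B : Type*}
    (op : B → Diagram F v w → Diagram G v' w')
    (hop : ∀ D c D' E, DiagramStep R D c D' → DiagramStep R' (op E D) c (op E D'))
    (y : B →₀ k) {x : Diagram F v w →₀ k} (hx : x ∈ relationIdeal R v w) :
    bilin k op y x ∈ relationIdeal R' v' w' := by
  induction hx using Submodule.span_induction with
  | mem x hx =>
    obtain ⟨D, D', c, h, rfl⟩ := hx
    induction y using Finsupp.induction_linear with
    | zero => simp
    | add y y' hy hy' => rw [map_add, LinearMap.add_apply]; exact add_mem hy hy'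
    | single E e =>
      have := (relationIdeal R' v' w').smul_mem e
        (Submodule.subset_span ⟨_, _, c, hop D c D' E h, rfl⟩)
      simpa [bilin_single, smul_sub, mul_comm] using this
  | zero => simp
  | add x x' _ _ hx hx' => rw [map_add]; exact add_mem hx hx'
  | smul a x _ hx => rw [map_smul]; exact Submodule.smul_mem _ a hx

/-- A bilinear map descends to quotients. -/
noncomputable def quotBilin {M N P : Type*} [AddCommGroup M] [AddCommGroup N] [AddCommGroup P] [Module k M]
    [Module k N] [Module k P] {p : Submodule k M} {q : Submodule k N} {r : Submodule k P}
    (B : M →ₗ[k] N →ₗ[k] P) (h₁ : ∀ m ∈ p, ∀ n, B m n ∈ r) (h₂ : ∀ m, ∀ n ∈ q, B m n ∈ r) :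
    (M ⧸ p) →ₗ[k] (N ⧸ q) →ₗ[k] (P ⧸ r) :=
  p.liftQ
    { toFun := fun m => q.mapQ r (B m) (h₂ m)
      map_add' := fun m m' => by ext n; simp
      map_smul' := fun a m => by ext n; simp }
    (fun m hm => by
      rw [LinearMap.mem_ker]
      ext n
      simpa using h₁ m hm n)

/-- Composition in the presented category, in diagrammatic order. -/
noncomputable def LinHom.comp {R : Rules k F} {u v w : List S} :
    LinHom R u v →ₗ[k] LinHom R v w →ₗ[k] LinHom R u w :=
  quotBilin (bilin k Diagram.comp)
    (fun _ hx y => bilin_mem_right _ (fun _ _ _ E h => h.comp_right E) hx y)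
    (fun x _ hy => bilin_mem_left _ (fun _ _ _ E h => h.comp_left E) x hy)

/-- Tensor product of arrows in the presented category. -/
noncomputable def LinHom.tensor {R : Rules k F} {v w v' w' : List S} :
    LinHom R v w →ₗ[k] LinHom R v' w' →ₗ[k] LinHom R (v ++ v') (w ++ w') :=
  quotBilin (bilin k Diagram.tensor)
    (fun _ hx y => bilin_mem_right _ (fun _ _ _ E h => h.tensor_right E) hx y)
    (fun x _ hy => bilin_mem_left _ (fun _ _ _ E h => h.tensor_left E) x hy)

/-- The class of a diagram in the presented category. -/
noncomputable def LinHom.ofDiagram (R : Rules k F) {v w : List S} (D : Diagram F v w) :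
    LinHom R v w :=
  Submodule.Quotient.mk (Finsupp.single D 1)

theorem LinHom.comp_ofDiagram {R : Rules k F} {u v w : List S} (D : Diagram F u v)
    (E : Diagram F v w) :
    LinHom.comp (ofDiagram R D) (ofDiagram R E) = ofDiagram R (D.comp E) := by
  change Submodule.Quotient.mk (bilin k Diagram.comp _ _) = _
  rw [bilin_single, mul_one]; rfl

theorem LinHom.tensor_ofDiagram {R : Rules k F} {v w v' w' : List S} (D : Diagram F v w)
    (E : Diagram F v' w') :
    LinHom.tensor (ofDiagram R D) (ofDiagram R E) = ofDiagram R (D.tensor E) := by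
  change Submodule.Quotient.mk (bilin k Diagram.tensor _ _) = _
  rw [bilin_single, mul_one]; rfl

theorem LinHom.add_comp {R : Rules k F} {u v w : List S} (f f' : LinHom R u v)
    (g : LinHom R v w) : comp (f + f') g = comp f g + comp f' g := by
  rw [map_add, LinearMap.add_apply]

theorem LinHom.comp_add {R : Rules k F} {u v w : List S} (f : LinHom R u v)
    (g g' : LinHom R v w) : comp f (g + g') = comp f g + comp f g' :=
  map_add _ _ _

theorem LinHom.smul_comp {R : Rules k F} {u v w : List S} (a : k) (f : LinHom R u v)
    (g : LinHom R v w) : comp (a • f) g = a • comp f g := by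
  rw [map_smul, LinearMap.smul_apply]

theorem LinHom.comp_smul {R : Rules k F} {u v w : List S} (a : k) (f : LinHom R u v)
    (g : LinHom R v w) : comp f (a • g) = a • comp f g :=
  map_smul _ _ _

theorem LinHom.add_tensor {R : Rules k F} {v w v' w' : List S} (f f' : LinHom R v w)
    (g : LinHom R v' w') : tensor (f + f') g = tensor f g + tensor f' g := by
  rw [map_add, LinearMap.add_apply]

theorem LinHom.smul_tensor {R : Rules k F} {v w v' w' : List S} (a : k) (f : LinHom R v w)
    (g : LinHom R v' w') : tensor (a • f) g = a • tensor f g := by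
  rw [map_smul, LinearMap.smul_apply]

/-- Induction on linear combinations of diagrams. -/
theorem LinHom.induction {R : Rules k F} {v w : List S} {p : LinHom R v w → Prop}
    (h0 : p 0) (hadd : ∀ x y, p x → p y → p (x + y)) (hsmul : ∀ (a : k) x, p x → p (a • x))
    (hD : ∀ D, p (ofDiagram R D)) (x : LinHom R v w) : p x := by
  induction x using Submodule.Quotient.induction_on with
  | H x =>
    induction x using Finsupp.induction_linear with
    | zero => exact h0
    | add x y hx hy => exact hadd _ _ hx hy
    | single D a =>
      have h : (Finsupp.single D a : Diagram F v w →₀ k) = a • Finsupp.single D 1 := by simp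
      rw [h]
      exact hsmul a _ (hD D)

/-- The strict monoidal `k`-linear category presented by generating objects `S`, generating arrows
`F` and relations `l = c • r` for the triples `(l, c, r)` of `R`. Its objects are words on `S`. -/
structure Presented (R : Rules k F) where
  /-- The word that is the object. -/
  word : List S

attribute [ext] Presented

namespace Presented

variable {R : Rules k F}

instance : Quiver (Presented R) where
  Hom X Y := LinHom R X.word Y.word

noncomputable instance : Category (Presented R) where
  id X := LinHom.ofDiagram R (Diagram.id F X.word)
  comp f g := LinHom.comp f g
  id_comp f := by
    induction f using LinHom.induction with
    | h0 => simp
    | hadd x y hx hy => rw [map_add, hx, hy]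
    | hsmul a x hx => rw [map_smul, hx]
    | hD D => rw [LinHom.comp_ofDiagram, Diagram.id_comp]
  comp_id f := by
    induction f using LinHom.induction with
    | h0 => simp
    | hadd x y hx hy => rw [map_add, LinearMap.add_apply, hx, hy]
    | hsmul a x hx => rw [map_smul, LinearMap.smul_apply, hx]
    | hD D => rw [LinHom.comp_ofDiagram, Diagram.comp_id]
  assoc f g h := by
    induction f using LinHom.induction with
    | h0 => simp
    | hadd x y hx hy => simp only [map_add, LinearMap.add_apply, hx, hy]
    | hsmul a x hx => simp only [map_smul, LinearMap.smul_apply, hx]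
    | hD D =>
      induction g using LinHom.induction with
      | h0 => simp
      | hadd x y hx hy => simp only [map_add, LinearMap.add_apply, hx, hy]
      | hsmul a x hx => simp only [map_smul, LinearMap.smul_apply, hx]
      | hD E =>
        induction h using LinHom.induction with
        | h0 => simp
        | hadd x y hx hy => simp only [map_add, hx, hy]
        | hsmul a x hx => simp only [map_smul, hx]
        | hD G => simp only [LinHom.comp_ofDiagram, Diagram.assoc]

noncomputable instance (X Y : Presented R) : AddCommGroup (X ⟶ Y) :=
  inferInstanceAs (AddCommGroup (LinHom R X.word Y.word))

noncomputable instance (X Y : Presented R) : Module k (X ⟶ Y) :=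
  inferInstanceAs (Module k (LinHom R X.word Y.word))

theorem add_comp {X Y Z : Presented R} (f f' : X ⟶ Y) (g : Y ⟶ Z) :
    (f + f') ≫ g = f ≫ g + f' ≫ g :=
  LinHom.add_comp (R := R) (u := X.word) (v := Y.word) (w := Z.word) f f' g

theorem comp_add {X Y Z : Presented R} (f : X ⟶ Y) (g g' : Y ⟶ Z) :
    f ≫ (g + g') = f ≫ g + f ≫ g' :=
  LinHom.comp_add (R := R) (u := X.word) (v := Y.word) (w := Z.word) f g g'

theorem smul_comp {X Y Z : Presented R} (a : k) (f : X ⟶ Y) (g : Y ⟶ Z) :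
    (a • f) ≫ g = a • f ≫ g :=
  LinHom.smul_comp (R := R) (u := X.word) (v := Y.word) (w := Z.word) a f g

theorem comp_smul {X Y Z : Presented R} (f : X ⟶ Y) (a : k) (g : Y ⟶ Z) :
    f ≫ (a • g) = a • f ≫ g :=
  LinHom.comp_smul (R := R) (u := X.word) (v := Y.word) (w := Z.word) a f g

noncomputable instance : Preadditive (Presented R) where
  add_comp _ _ _ f f' g := by exact add_comp f f' g
  comp_add _ _ _ f g g' := by exact comp_add f g g'

noncomputable instance : Linear k (Presented R) where
  smul_comp _ _ _ a f g := by exact smul_comp a f g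
  comp_smul _ _ _ f a g := by exact comp_smul f a g

theorem comp_eqToHom_of_heq {X Y X' Y' : Presented R} (hX : X = X') (hY : Y = Y') {f : X ⟶ Y}
    {g : X' ⟶ Y'} (h : HEq f g) : f ≫ eqToHom hY = eqToHom hX ≫ g := by
  subst hX hY
  cases h
  simp

theorem ofDiagram_heq {v w v' w' : List S} (hv : v = v') (hw : w = w') {D : Diagram F v w}
    {D' : Diagram F v' w'} (h : HEq D D') :
    HEq (LinHom.ofDiagram R D) (LinHom.ofDiagram R D') := by
  subst hv hw
  cases h
  rfl

noncomputable instance : MonoidalCategoryStruct (Presented R) where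
  tensorObj X Y := ⟨X.word ++ Y.word⟩
  tensorUnit := ⟨[]⟩
  tensorHom f g := LinHom.tensor f g
  whiskerLeft X _ _ f := LinHom.tensor (𝟙 X) f
  whiskerRight f Y := LinHom.tensor f (𝟙 Y)
  associator X Y Z := eqToIso (Presented.ext (List.append_assoc X.word Y.word Z.word))
  leftUnitor X := eqToIso (Presented.ext (List.nil_append X.word))
  rightUnitor X := eqToIso (Presented.ext (List.append_nil X.word))

open MonoidalCategory

theorem associator_hom (X Y Z : Presented R) :
    (α_ X Y Z).hom = eqToHom (Presented.ext (List.append_assoc X.word Y.word Z.word)) := rfl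

theorem leftUnitor_hom (X : Presented R) :
    (λ_ X).hom = eqToHom (Presented.ext (List.nil_append X.word)) := rfl

theorem rightUnitor_hom (X : Presented R) :
    (ρ_ X).hom = eqToHom (Presented.ext (List.append_nil X.word)) := rfl

theorem eqToHom_tensor_eqToHom {X X' Y Y' : Presented R} (h : X = X') (h' : Y = Y') :
    eqToHom h ⊗ₘ eqToHom h' = eqToHom (by rw [h, h']) := by
  subst h h'
  exact (LinHom.tensor_ofDiagram _ _).trans (by rw [Diagram.id_tensor_id]; rfl)

theorem tensorHom_comp {X₁ Y₁ Z₁ X₂ Y₂ Z₂ : Presented R} (f₁ : X₁ ⟶ Y₁) (f₂ : X₂ ⟶ Y₂)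
    (g₁ : Y₁ ⟶ Z₁) (g₂ : Y₂ ⟶ Z₂) :
    (f₁ ⊗ₘ f₂) ≫ (g₁ ⊗ₘ g₂) = (f₁ ≫ g₁) ⊗ₘ (f₂ ≫ g₂) := by
  change LinHom.comp (LinHom.tensor f₁ f₂) (LinHom.tensor g₁ g₂) =
    LinHom.tensor (LinHom.comp f₁ g₁) (LinHom.comp f₂ g₂)
  induction f₁ using LinHom.induction with
  | h0 => simp
  | hadd x y hx hy => simp only [map_add, LinearMap.add_apply, hx, hy]
  | hsmul a x hx => simp only [map_smul, LinearMap.smul_apply, hx]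
  | hD D₁ =>
    induction f₂ using LinHom.induction with
    | h0 => simp
    | hadd x y hx hy => simp only [map_add, LinearMap.add_apply, hx, hy]
    | hsmul a x hx => simp only [map_smul, LinearMap.smul_apply, hx]
    | hD D₂ =>
      induction g₁ using LinHom.induction with
      | h0 => simp
      | hadd x y hx hy => simp only [map_add, LinearMap.add_apply, hx, hy]
      | hsmul a x hx => simp only [map_smul, LinearMap.smul_apply, hx]
      | hD E₁ =>
        induction g₂ using LinHom.induction with
        | h0 => simp
        | hadd x y hx hy => simp only [map_add, hx, hy]
        | hsmul a x hx => simp only [map_smul, hx]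
        | hD E₂ => simp only [LinHom.comp_ofDiagram, LinHom.tensor_ofDiagram, Diagram.exchange]

theorem associator_naturality {X₁ X₂ X₃ Y₁ Y₂ Y₃ : Presented R} (f₁ : X₁ ⟶ Y₁) (f₂ : X₂ ⟶ Y₂)
    (f₃ : X₃ ⟶ Y₃) :
    ((f₁ ⊗ₘ f₂) ⊗ₘ f₃) ≫ (α_ Y₁ Y₂ Y₃).hom = (α_ X₁ X₂ X₃).hom ≫ (f₁ ⊗ₘ f₂ ⊗ₘ f₃) := by
  change LinHom.comp (LinHom.tensor (LinHom.tensor f₁ f₂) f₃) (α_ Y₁ Y₂ Y₃).hom =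
    LinHom.comp (α_ X₁ X₂ X₃).hom (LinHom.tensor f₁ (LinHom.tensor f₂ f₃))
  induction f₁ using LinHom.induction with
  | h0 => simp
  | hadd x y hx hy => simp only [map_add, LinearMap.add_apply, hx, hy]
  | hsmul a x hx => simp only [map_smul, LinearMap.smul_apply, hx]
  | hD D₁ =>
    induction f₂ using LinHom.induction with
    | h0 => simp
    | hadd x y hx hy => simp only [map_add, LinearMap.add_apply, hx, hy]
    | hsmul a x hx => simp only [map_smul, LinearMap.smul_apply, hx]
    | hD D₂ =>
      induction f₃ using LinHom.induction with
      | h0 => simp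
      | hadd x y hx hy => simp only [map_add, LinearMap.add_apply, hx, hy]
      | hsmul a x hx => simp only [map_smul, LinearMap.smul_apply, hx]
      | hD D₃ =>
        simp only [LinHom.tensor_ofDiagram]
        exact comp_eqToHom_of_heq (Presented.ext (List.append_assoc _ _ _))
          (Presented.ext (List.append_assoc _ _ _)) (ofDiagram_heq (List.append_assoc _ _ _)
          (List.append_assoc _ _ _) (Diagram.tensor_assoc D₁ D₂ D₃))

theorem leftUnitor_naturality {X Y : Presented R} (f : X ⟶ Y) :
    (𝟙 (𝟙_ (Presented R)) ⊗ₘ f) ≫ (λ_ Y).hom = (λ_ X).hom ≫ f := by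
  change LinHom.comp (LinHom.tensor (LinHom.ofDiagram R (Diagram.id F [])) f) (λ_ Y).hom =
    LinHom.comp (λ_ X).hom f
  induction f using LinHom.induction with
  | h0 => simp
  | hadd x y hx hy => simp only [map_add, LinearMap.add_apply, hx, hy]
  | hsmul a x hx => simp only [map_smul, LinearMap.smul_apply, hx]
  | hD D =>
    simp only [LinHom.tensor_ofDiagram]
    exact comp_eqToHom_of_heq rfl rfl (ofDiagram_heq rfl rfl (heq_of_eq (Diagram.id_tensor D)))

theorem rightUnitor_naturality {X Y : Presented R} (f : X ⟶ Y) :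
    (f ⊗ₘ 𝟙 (𝟙_ (Presented R))) ≫ (ρ_ Y).hom = (ρ_ X).hom ≫ f := by
  change LinHom.comp (LinHom.tensor f (LinHom.ofDiagram R (Diagram.id F []))) (ρ_ Y).hom =
    LinHom.comp (ρ_ X).hom f
  induction f using LinHom.induction with
  | h0 => simp
  | hadd x y hx hy => simp only [map_add, LinearMap.add_apply, hx, hy]
  | hsmul a x hx => simp only [map_smul, LinearMap.smul_apply, hx]
  | hD D =>
    simp only [LinHom.tensor_ofDiagram]
    exact comp_eqToHom_of_heq (Presented.ext (List.append_nil _))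
      (Presented.ext (List.append_nil _)) (ofDiagram_heq (List.append_nil _)
      (List.append_nil _) (Diagram.tensor_id D))

/-- The tensor product makes the presented category monoidal; it is strict, since all associators
and unitors are identities (along equalities of words). -/
noncomputable instance : MonoidalCategory (Presented R) :=
  MonoidalCategory.ofTensorHom
    (id_tensorHom_id := fun X Y => eqToHom_tensor_eqToHom (rfl : X = X) (rfl : Y = Y))
    (id_tensorHom := fun _ _ _ _ => rfl)
    (tensorHom_id := fun _ _ => rfl)
    (tensorHom_comp_tensorHom := tensorHom_comp)
    (associator_naturality := associator_naturality)
    (leftUnitor_naturality := leftUnitor_naturality)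
    (rightUnitor_naturality := rightUnitor_naturality)
    (pentagon := fun _ _ _ _ => by
      simp only [associator_hom, ← eqToHom_refl _ rfl, eqToHom_tensor_eqToHom, eqToHom_trans])
    (triangle := fun _ _ => by
      simp only [associator_hom, leftUnitor_hom, rightUnitor_hom, ← eqToHom_refl _ rfl,
        eqToHom_tensor_eqToHom, eqToHom_trans])

instance : MonoidalPreadditive (Presented R) where
  whiskerLeft_zero {X _ _} := map_zero (LinHom.tensor (R := R) (𝟙 X))
  zero_whiskerRight {X _ _} := LinearMap.map_zero₂ (LinHom.tensor (R := R)) (𝟙 X)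
  whiskerLeft_add {X _ _} f g := map_add (LinHom.tensor (R := R) (𝟙 X)) f g
  add_whiskerRight {_ _ _} f g := LinHom.add_tensor f g _

instance : MonoidalLinear k (Presented R) where
  whiskerLeft_smul X _ _ r f := map_smul (LinHom.tensor (R := R) (𝟙 X)) r f
  smul_whiskerRight r _ _ f _ := LinHom.smul_tensor r f _

/-- The arrow of the presented category that a diagram represents. -/
noncomputable def ofDiagram (R : Rules k F) {v w : List S} (D : Diagram F v w) :
    (⟨v⟩ : Presented R) ⟶ ⟨w⟩ :=
  LinHom.ofDiagram R D

end Presented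

end Presented

end StrictMon

/-! ### The oriented Temperley–Lieb category -/

namespace OrientedTL

open StrictMon

/-- The two generating objects `∨` (`down`) and `∧` (`up`). -/
inductive Orient : Type
  | down
  | up

open Orient

/-- The four generating arrows. -/
inductive CapCup : List Orient → List Orient → Type
  | capPlus : CapCup [down, up] []
  | capMinus : CapCup [up, down] []
  | cupPlus : CapCup [] [down, up]
  | cupMinus : CapCup [] [up, down]

/-- The cap `∨∧ → ∅`. -/
abbrev capP : Arrow CapCup [down, up] [] := .gen .capPlus
/-- The cap `∧∨ → ∅`. -/
abbrev capM : Arrow CapCup [up, down] [] := .gen .capMinus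
/-- The cup `∅ → ∨∧`. -/
abbrev cupP : Arrow CapCup [] [down, up] := .gen .cupPlus
/-- The cup `∅ → ∧∨`. -/
abbrev cupM : Arrow CapCup [] [up, down] := .gen .cupMinus
/-- The identity of `∧`. -/
abbrev idUp : Arrow CapCup [up] [up] := .id [up]
/-- The identity of `∨`. -/
abbrev idDown : Arrow CapCup [down] [down] := .id [down]

/-- The rules `l → c • r`: the four zigzags are straightened, the counterclockwise bubble is sent
to `q` and the clockwise one to `q⁻¹`. -/
inductive Rule {k : Type*} [CommRing k] (q : kˣ) : Rules k CapCup
  | zigzagUpLeft : Rule q ((idUp.tensor cupP).comp (capM.tensor idUp)) 1 idUp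
  | zigzagUpRight : Rule q ((cupM.tensor idUp).comp (idUp.tensor capP)) 1 idUp
  | zigzagDownLeft : Rule q ((idDown.tensor cupM).comp (capP.tensor idDown)) 1 idDown
  | zigzagDownRight : Rule q ((cupP.tensor idDown).comp (idDown.tensor capM)) 1 idDown
  | bubbleCounterclockwise : Rule q (cupP.comp capP) (q : k) (.id [])
  | bubbleClockwise : Rule q (cupM.comp capM) ((q⁻¹ : kˣ) : k) (.id [])

/-- The oriented Temperley–Lieb category: the strict monoidal linear category presented by the
two generating objects, the four generating arrows and the relations `l = c • r`. -/
abbrev TLO {k : Type*} [CommRing k] (q : kˣ) : Type :=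
  Presented (Rule q)

end OrientedTL

/-! No critical pair is examined: convergence comes from three invariants of diagrams. The number of
generators drops at every step, which gives termination. An integer weight, the turning, vanishes on
zigzags and is `±1` on bubbles, so `q ^ turn` absorbs exactly the scalar of each rule. The third
invariant is the set of boundary colourings: a pair of boundary colourings is admissible if it
extends to a colouring of every strand by two colours. Straightening a zigzag does not change this
relation, and neither does erasing a loop, since a loop can always be coloured.

The colourings separate normal forms. A cup that comes before caps either meets one in a bubble or a
zigzag, so that a rule applies, or slides past it by exchange; hence a diagram in normal form
consists of caps followed by cups (`CapsThen.cupAt_comp`, `sorted`). Such a diagram can be read off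
its colourings: two neighbouring source places have the same colour in all of them exactly when a
cap joins these places, and that cap can be brought to the front (`CapsThen.exists_cap`). Removing
caps one by one, and then the cups by reflection, gives `faithful_capsCups`.

So each diagram `D` has a unique normal form `N`, and every reduction accumulates the same
coefficient `q ^ (turn D - turn N)`. The linear map `nfMap` defined by these data is constant along
linear steps, which yields confluence, and it factors through the presented category, where it gives
coordinates in the normal forms. -/

namespace StrictMon

variable {S : Type} {F : List S → List S → Type}

local infix:50 " ≃ₐ " => ArrowEquiv

/-! ### Calculus of formal arrows up to the laws of strict monoidal categories -/

/-- Allows a heterogeneous equivalence to be replaced, by substitution, with one between parallel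
arrows. -/
theorem ArrowEquiv.src_tgt_eq {v w v' w' : List S} {f : Arrow F v w} {g : Arrow F v' w'}
    (h : f ≃ₐ g) : v = v' ∧ w = w' := by
  induction h <;> simp_all

theorem ArrowEquiv.src_eq {v w v' w' : List S} {f : Arrow F v w} {g : Arrow F v' w'}
    (h : f ≃ₐ g) : v = v' := h.src_tgt_eq.1

theorem ArrowEquiv.tgt_eq {v w v' w' : List S} {f : Arrow F v w} {g : Arrow F v' w'}
    (h : f ≃ₐ g) : w = w' := h.src_tgt_eq.2

instance {v w v' w' v'' w'' : List S} :
    Trans (@ArrowEquiv S F v w v' w') (@ArrowEquiv S F v' w' v'' w'')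
      (@ArrowEquiv S F v w v'' w'') where
  trans := ArrowEquiv.trans

/-- Transport of a formal arrow along equalities of words. -/
def Arrow.cast {v w v' w' : List S} (hv : v = v') (hw : w = w') (f : Arrow F v w) :
    Arrow F v' w' :=
  hv ▸ hw ▸ f

theorem Arrow.cast_equiv {v w v' w' : List S} (hv : v = v') (hw : w = w') (f : Arrow F v w) :
    f.cast hv hw ≃ₐ f := by
  subst hv hw
  exact .refl f

/-- Provides representatives over rebracketed words, so that composites of slices typecheck. -/
theorem Arrow.exists_equiv {v w v' w' : List S} (f : Arrow F v w) (hv : v' = v) (hw : w' = w) :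
    ∃ g : Arrow F v' w', g ≃ₐ f :=
  ⟨_, f.cast_equiv hv.symm hw.symm⟩

/-- The formal arrow `f` with identities on both sides. -/
abbrev Arrow.slice {v w : List S} (a : List S) (f : Arrow F v w) (b : List S) :
    Arrow F (a ++ (v ++ b)) (a ++ (w ++ b)) :=
  (Arrow.id a).tensor (f.tensor (Arrow.id b))

namespace ArrowEquiv

theorem slice_congr {v w v' w' : List S} {f : Arrow F v w} {g : Arrow F v' w'} (a b : List S)
    (h : f ≃ₐ g) : f.slice a b ≃ₐ g.slice a b :=
  tensor_congr (refl _) (tensor_congr h (refl _))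

theorem tensor_comp_id {u v w : List S} (f : Arrow F u v) (g : Arrow F v w) (b : List S) :
    (f.comp g).tensor (Arrow.id b) ≃ₐ (f.tensor (Arrow.id b)).comp (g.tensor (Arrow.id b)) :=
  (tensor_congr (refl _) (id_comp _).symm).trans (exchange _ _ _ _).symm

theorem id_tensor_comp {u v w : List S} (f : Arrow F u v) (g : Arrow F v w) (a : List S) :
    (Arrow.id a).tensor (f.comp g) ≃ₐ ((Arrow.id a).tensor f).comp ((Arrow.id a).tensor g) :=
  (tensor_congr (id_comp _).symm (refl _)).trans (exchange _ _ _ _).symm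

theorem slice_comp {u v w : List S} (f : Arrow F u v) (g : Arrow F v w) (a b : List S) :
    (f.comp g).slice a b ≃ₐ (f.slice a b).comp (g.slice a b) :=
  (tensor_congr (refl _) (tensor_comp_id f g b)).trans (id_tensor_comp _ _ a)

theorem slice_id (a v b : List S) : (Arrow.id (F := F) v).slice a b ≃ₐ Arrow.id (a ++ (v ++ b)) :=
  (tensor_congr (refl _) (id_tensor_id _ _)).trans (id_tensor_id _ _)

theorem slice_nil {v w : List S} (f : Arrow F v w) : f.slice [] [] ≃ₐ f :=
  (id_tensor _).trans (tensor_id _)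

theorem tensor_id_slice {v w : List S} (f : Arrow F v w) (a b d : List S) :
    (f.tensor (Arrow.id d)).slice a b ≃ₐ f.slice a (d ++ b) :=
  tensor_congr (refl _) ((tensor_assoc _ _ _).trans (tensor_congr (refl _) (id_tensor_id _ _)))

theorem id_tensor_slice {v w : List S} (f : Arrow F v w) (a b c : List S) :
    ((Arrow.id c).tensor f).slice a b ≃ₐ f.slice (a ++ c) b :=
  ((tensor_congr (refl _) (tensor_assoc _ _ _)).trans (tensor_assoc _ _ _).symm).trans
    (tensor_congr (id_tensor_id _ _) (refl _))

theorem tensor_left_right {v w v' w' : List S} (f : Arrow F v w) (g : Arrow F v' w') :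
    f.tensor g ≃ₐ (f.tensor (Arrow.id v')).comp ((Arrow.id w).tensor g) :=
  ((exchange _ _ _ _).trans (tensor_congr (comp_id _) (id_comp _))).symm

theorem tensor_right_left {v w v' w' : List S} (f : Arrow F v w) (g : Arrow F v' w') :
    f.tensor g ≃ₐ ((Arrow.id v).tensor g).comp (f.tensor (Arrow.id w')) :=
  ((exchange _ _ _ _).trans (tensor_congr (id_comp _) (comp_id _))).symm

/-- Slices at disjoint places commute. -/
theorem slice_exchange {v w v' w' x y y' z : List S} {f : Arrow F v w} {g : Arrow F v' w'}
    {a b c : List S} {p : Arrow F x y} {r : Arrow F y z} {r' : Arrow F x y'} {p' : Arrow F y' z}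
    (hp : p ≃ₐ f.slice a (c ++ (v' ++ b))) (hr : r ≃ₐ g.slice (a ++ (w ++ c)) b)
    (hr' : r' ≃ₐ g.slice (a ++ (v ++ c)) b) (hp' : p' ≃ₐ f.slice a (c ++ (w' ++ b))) :
    p.comp r ≃ₐ r'.comp p' := by
  have hf : ∀ d, (f.tensor (Arrow.id (c ++ d))).slice a b ≃ₐ f.slice a (c ++ (d ++ b)) := fun d =>
    (tensor_id_slice f a b (c ++ d)).trans (by rw [List.append_assoc]; exact refl _)
  have hg : ∀ d, ((Arrow.id d).tensor ((Arrow.id c).tensor g)).slice a b ≃ₐ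
      g.slice (a ++ (d ++ c)) b := fun d =>
    (slice_congr a b ((tensor_assoc _ _ _).symm.trans
      (tensor_congr (id_tensor_id _ _) (refl _)))).trans (id_tensor_slice g a b (d ++ c))
  -- Both composites are the slice of `f ⊗ 1_c ⊗ g`, in which neither arrow precedes the other.
  have h₁ : p.comp r ≃ₐ (f.tensor ((Arrow.id c).tensor g)).slice a b :=
    (comp_congr (hp.trans (hf v').symm) (hr.trans (hg w).symm)).trans
      ((slice_comp _ _ a b).symm.trans (slice_congr a b (tensor_left_right _ _).symm))
  have h₂ : r'.comp p' ≃ₐ (f.tensor ((Arrow.id c).tensor g)).slice a b :=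
    (comp_congr (hr'.trans (hg v).symm) (hp'.trans (hf w').symm)).trans
      ((slice_comp _ _ a b).symm.trans (slice_congr a b (tensor_right_left _ _).symm))
  exact h₁.trans h₂.symm

end ArrowEquiv

/-! ### Applicability of a rule up to equivalence -/

section HasStep

variable {k : Type*}

/-- Up to the laws of strict monoidal categories, a rule applies to `f`. -/
def HasStep (R : Rules k F) {v w : List S} (f : Arrow F v w) : Prop :=
  ∃ (v' w' : List S) (f₁ f₂ : Arrow F v' w') (c : k), f ≃ₐ f₁ ∧ ArrowStep R f₁ c f₂

variable {R : Rules k F}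

theorem HasStep.congr {v w v' w' : List S} {f : Arrow F v w} {g : Arrow F v' w'}
    (hg : HasStep R g) (h : f ≃ₐ g) : HasStep R f := by
  obtain ⟨_, _, f₁, f₂, c, h', hs⟩ := hg
  exact ⟨_, _, f₁, f₂, c, h.trans h', hs⟩

theorem HasStep.comp_right {u v w : List S} {f : Arrow F u v} (hf : HasStep R f)
    (g : Arrow F v w) : HasStep R (f.comp g) := by
  obtain ⟨_, _, f₁, f₂, c, h, hs⟩ := hf
  obtain ⟨rfl, rfl⟩ := h.src_tgt_eq
  exact ⟨_, _, _, _, c, .comp_congr h (.refl g), hs.comp_right g⟩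

theorem HasStep.comp_left {u v w : List S} (f : Arrow F u v) {g : Arrow F v w}
    (hg : HasStep R g) : HasStep R (f.comp g) := by
  obtain ⟨_, _, g₁, g₂, c, h, hs⟩ := hg
  obtain ⟨rfl, rfl⟩ := h.src_tgt_eq
  exact ⟨_, _, _, _, c, .comp_congr (.refl f) h, hs.comp_left f⟩

theorem HasStep.slice {v w : List S} {f : Arrow F v w} (hf : HasStep R f) (a b : List S) :
    HasStep R (f.slice a b) := by
  obtain ⟨_, _, f₁, f₂, c, h, hs⟩ := hf
  exact ⟨_, _, _, _, c, h.slice_congr a b, (hs.tensor_right _).tensor_left _⟩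

theorem IsNormalForm.not_hasStep {v w : List S} {f : Arrow F v w}
    (h : IsNormalForm R (Diagram.mk f)) : ¬ HasStep R f := by
  rintro ⟨_, _, f₁, f₂, c, h', hs⟩
  obtain ⟨rfl, rfl⟩ := h'.src_tgt_eq
  exact h c _ ⟨f₁, f₂, (Quotient.sound h').symm, rfl, hs⟩

end HasStep

end StrictMon

namespace OrientedTL

open StrictMon Orient

local infix:50 " ≃ₐ " => ArrowEquiv

/-! ### Caps, cups and reflection -/

/-- The opposite orientation. -/
def Orient.dual : Orient → Orient
  | down => up
  | up => down

/-- The cap whose left leg is `x`. -/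
def cap : ∀ x : Orient, Arrow CapCup [x, x.dual] []
  | down => capP
  | up => capM

/-- The cup whose left leg is `x`. -/
def cup : ∀ x : Orient, Arrow CapCup [] [x, x.dual]
  | down => cupP
  | up => cupM

/-- A single cap between identities. -/
abbrev capAt (a : List Orient) (x : Orient) (b : List Orient) :
    Arrow CapCup (a ++ x :: x.dual :: b) (a ++ b) :=
  (cap x).slice a b

/-- A single cup between identities. -/
abbrev cupAt (a : List Orient) (x : Orient) (b : List Orient) :
    Arrow CapCup (a ++ b) (a ++ x :: x.dual :: b) :=
  (cup x).slice a b

/-- Reflection of generators, which exchanges caps and cups. -/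
def CapCup.reflect : ∀ {v w : List Orient}, CapCup v w → CapCup w v
  | _, _, .capPlus => .cupPlus
  | _, _, .capMinus => .cupMinus
  | _, _, .cupPlus => .capPlus
  | _, _, .cupMinus => .capMinus

/-- Reflection of formal arrows in a horizontal line. -/
def reflect : ∀ {v w : List Orient}, Arrow CapCup v w → Arrow CapCup w v
  | _, _, .gen g => .gen g.reflect
  | _, _, .id v => .id v
  | _, _, .comp f g => (reflect g).comp (reflect f)
  | _, _, .tensor f g => (reflect f).tensor (reflect g)

theorem reflect_reflect {v w : List Orient} (f : Arrow CapCup v w) : reflect (reflect f) = f := by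
  induction f with
  | gen g => cases g <;> rfl
  | id v => rfl
  | comp f g hf hg => simp [reflect, hf, hg]
  | tensor f g hf hg => simp [reflect, hf, hg]

theorem reflect_cupAt (a : List Orient) (x : Orient) (b : List Orient) :
    reflect (cupAt a x b) = capAt a x b := by
  cases x <;> rfl

theorem reflect_congr {v w v' w' : List Orient} {f : Arrow CapCup v w} {g : Arrow CapCup v' w'}
    (h : f ≃ₐ g) : reflect f ≃ₐ reflect g := by
  induction h with
  | refl f => exact .refl _
  | symm _ ih => exact ih.symm
  | trans _ _ ih ih' => exact ih.trans ih'
  | comp_congr _ _ ih ih' => exact .comp_congr ih' ih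
  | tensor_congr _ _ ih ih' => exact .tensor_congr ih ih'
  | id_comp f => exact .comp_id _
  | comp_id f => exact .id_comp _
  | assoc f g h => exact (ArrowEquiv.assoc _ _ _).symm
  | id_tensor f => exact .id_tensor _
  | tensor_id f => exact .tensor_id _
  | tensor_assoc f g h => exact .tensor_assoc _ _ _
  | id_tensor_id v w => exact .id_tensor_id _ _
  | exchange f f' g g' => exact .exchange _ _ _ _

/-! ### Colourings of diagrams -/

/-- Colourings of the legs of a generator: both legs get the same colour. -/
def CapCup.Coloring : ∀ {v w : List Orient}, CapCup v w → List Bool → List Bool → Prop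
  | _, _, .capPlus, l, m => ∃ s, l = [s, s] ∧ m = []
  | _, _, .capMinus, l, m => ∃ s, l = [s, s] ∧ m = []
  | _, _, .cupPlus, l, m => l = [] ∧ ∃ s, m = [s, s]
  | _, _, .cupMinus, l, m => l = [] ∧ ∃ s, m = [s, s]

/-- `Coloring f l m` says that the colours `l` of the source and `m` of the target of `f` extend
to a colouring of all strands of `f`. -/
def Coloring : ∀ {v w : List Orient}, Arrow CapCup v w → List Bool → List Bool → Prop
  | _, _, .gen g, l, m => g.Coloring l m
  | _, _, .id v, l, m => l = m ∧ l.length = v.length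
  | _, _, .comp f g, l, m => ∃ n, Coloring f l n ∧ Coloring g n m
  | _, _, .tensor f g, l, m => ∃ l₁ l₂ m₁ m₂,
      l = l₁ ++ l₂ ∧ m = m₁ ++ m₂ ∧ Coloring f l₁ m₁ ∧ Coloring g l₂ m₂

/-- The lengths determine where the colours of a tensor product are cut. -/
theorem Coloring.length {v w : List Orient} {f : Arrow CapCup v w} {l m : List Bool}
    (h : Coloring f l m) : l.length = v.length ∧ m.length = w.length := by
  induction f generalizing l m with
  | gen g =>
    cases g <;> simp only [Coloring, CapCup.Coloring] at h <;> rcases h with ⟨s, h⟩ <;>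
      first
      | (obtain ⟨rfl, rfl⟩ := h; simp)
      | (obtain ⟨t, rfl⟩ := h; subst s; simp)
  | id v => obtain ⟨rfl, h⟩ := h; exact ⟨h, h⟩
  | comp f g hf hg => obtain ⟨n, h, h'⟩ := h; exact ⟨(hf h).1, (hg h').2⟩
  | tensor f g hf hg =>
    obtain ⟨l₁, l₂, m₁, m₂, rfl, rfl, h, h'⟩ := h
    simp [hf h, hg h']

theorem coloring_reflect {v w : List Orient} (f : Arrow CapCup v w) (l m : List Bool) :
    Coloring (reflect f) l m ↔ Coloring f m l := by
  induction f generalizing l m with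
  | gen g =>
    cases g <;> simp [Coloring, reflect, CapCup.reflect, CapCup.Coloring, and_comm]
  | id v => simp only [Coloring, reflect]; constructor <;> (rintro ⟨rfl, h⟩; exact ⟨rfl, h⟩)
  | comp f g hf hg => simp only [Coloring, reflect, hf, hg, and_comm]
  | tensor f g hf hg =>
    simp only [Coloring, reflect, hf, hg]
    constructor <;> (rintro ⟨a, b, c, d, h₁, h₂, h₃, h₄⟩; exact ⟨c, d, a, b, h₂, h₁, h₃, h₄⟩)

/-- Colourings form a strict monoidal functor to relations between lists, with composition of
relations and concatenation. In the exchange law, lengths force the two cuts of the middle list to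
agree. -/
theorem coloring_congr {v w v' w' : List Orient} {f : Arrow CapCup v w} {g : Arrow CapCup v' w'}
    (h : f ≃ₐ g) (l m : List Bool) : Coloring f l m ↔ Coloring g l m := by
  induction h generalizing l m with
  | refl f => rfl
  | symm _ ih => exact (ih l m).symm
  | trans _ _ ih ih' => exact (ih l m).trans (ih' l m)
  | comp_congr _ _ ih ih' => simp only [Coloring, ih, ih']
  | tensor_congr _ _ ih ih' => simp only [Coloring, ih, ih']
  | id_comp f =>
    constructor
    · rintro ⟨n, ⟨rfl, _⟩, h⟩; exact h
    · intro h; exact ⟨l, ⟨rfl, h.length.1⟩, h⟩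
  | comp_id f =>
    constructor
    · rintro ⟨n, h, rfl, _⟩; exact h
    · intro h; exact ⟨m, h, rfl, h.length.2⟩
  | assoc f g h =>
    constructor
    · rintro ⟨n, ⟨n', h₁, h₂⟩, h₃⟩; exact ⟨n', h₁, n, h₂, h₃⟩
    · rintro ⟨n', h₁, n, h₂, h₃⟩; exact ⟨n, ⟨n', h₁, h₂⟩, h₃⟩
  | id_tensor f =>
    constructor
    · rintro ⟨l₁, l₂, m₁, m₂, rfl, rfl, ⟨rfl, h⟩, h'⟩
      obtain rfl := List.length_eq_zero_iff.1 h
      exact h'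
    · intro h; exact ⟨[], l, [], m, rfl, rfl, ⟨rfl, rfl⟩, h⟩
  | tensor_id f =>
    constructor
    · rintro ⟨l₁, l₂, m₁, m₂, rfl, rfl, h', rfl, h⟩
      obtain rfl := List.length_eq_zero_iff.1 h
      simpa using h'
    · intro h; exact ⟨l, [], m, [], by simp, by simp, h, rfl, rfl⟩
  | tensor_assoc f g h =>
    constructor
    · rintro ⟨_, l₃, _, m₃, rfl, rfl, ⟨l₁, l₂, m₁, m₂, rfl, rfl, h₁, h₂⟩, h₃⟩
      exact ⟨l₁, _, m₁, _, List.append_assoc .., List.append_assoc .., h₁,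
        l₂, l₃, m₂, m₃, rfl, rfl, h₂, h₃⟩
    · rintro ⟨l₁, _, m₁, _, rfl, rfl, h₁, l₂, l₃, m₂, m₃, rfl, rfl, h₂, h₃⟩
      exact ⟨_, l₃, _, m₃, (List.append_assoc ..).symm, (List.append_assoc ..).symm,
        ⟨l₁, l₂, m₁, m₂, rfl, rfl, h₁, h₂⟩, h₃⟩
  | id_tensor_id v w =>
    constructor
    · rintro ⟨l₁, l₂, m₁, m₂, rfl, rfl, ⟨rfl, h⟩, rfl, h'⟩
      exact ⟨rfl, by simp [h, h']⟩
    · rintro ⟨rfl, h⟩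
      refine ⟨l.take v.length, l.drop v.length, l.take v.length, l.drop v.length, by simp, by simp,
        ⟨rfl, ?_⟩, rfl, ?_⟩ <;> simp at h ⊢ <;> omega
  | exchange f f' g g' =>
    constructor
    · rintro ⟨_, ⟨l₁, l₂, n₁, n₂, rfl, rfl, h₁, h₂⟩, n₁', n₂', m₁, m₂, h, rfl, h₁', h₂'⟩
      obtain ⟨rfl, rfl⟩ := List.append_inj h (h₁.length.2.trans h₁'.length.1.symm)
      exact ⟨l₁, l₂, m₁, m₂, rfl, rfl, ⟨n₁, h₁, h₁'⟩, n₂, h₂, h₂'⟩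
    · rintro ⟨l₁, l₂, m₁, m₂, rfl, rfl, ⟨n₁, h₁, h₁'⟩, n₂, h₂, h₂'⟩
      exact ⟨_, ⟨l₁, l₂, n₁, n₂, rfl, rfl, h₁, h₂⟩, n₁, n₂, m₁, m₂, rfl, rfl, h₁', h₂'⟩

theorem coloring_replicate {v w : List Orient} (f : Arrow CapCup v w) (s : Bool) :
    Coloring f (List.replicate v.length s) (List.replicate w.length s) := by
  induction f with
  | gen g => cases g <;> simp [Coloring, CapCup.Coloring, List.replicate]
  | id v => exact ⟨rfl, List.length_replicate⟩
  | comp f g hf hg => exact ⟨_, hf, hg⟩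
  | tensor f g hf hg =>
    exact ⟨_, _, _, _, by rw [List.length_append, List.replicate_add],
      by rw [List.length_append, List.replicate_add], hf, hg⟩

theorem coloring_capAt_comp {a b w : List Orient} {x : Orient} (g : Arrow CapCup (a ++ b) w)
    (l m : List Bool) : Coloring ((capAt a x b).comp g) l m ↔
      ∃ l₁ s l₂, l = l₁ ++ s :: s :: l₂ ∧ l₁.length = a.length ∧ Coloring g (l₁ ++ l₂) m := by
  have hc : ∀ l m, Coloring (cap x) l m ↔ ∃ s, l = [s, s] ∧ m = [] := by
    cases x <;> exact fun _ _ => Iff.rfl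
  constructor
  · rintro ⟨_, ⟨l₁, _, _, _, rfl, rfl, ⟨rfl, h₁⟩, _, l₂, _, _, rfl, rfl, h, rfl, h₂⟩, hg⟩
    obtain ⟨s, rfl, rfl⟩ := (hc _ _).1 h
    exact ⟨l₁, s, l₂, rfl, h₁, hg⟩
  · rintro ⟨l₁, s, l₂, rfl, h₁, hg⟩
    have h := hg.length.1
    rw [List.length_append, List.length_append] at h
    exact ⟨_, ⟨l₁, _, l₁, _, rfl, rfl, ⟨rfl, h₁⟩, _, l₂, _, l₂, rfl, rfl,
      (hc _ _).2 ⟨s, rfl, rfl⟩, rfl, by omega⟩, hg⟩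

/-- The length of `l₁` locates the cap, so the splitting of the list is unique. No information about
`g` is lost when a cap is put before it. -/
theorem coloring_capAt_comp_insert {a b w : List Orient} {x : Orient} (g : Arrow CapCup (a ++ b) w)
    (l₁ l₂ m : List Bool) (s : Bool) (h₁ : l₁.length = a.length) :
    Coloring ((capAt a x b).comp g) (l₁ ++ s :: s :: l₂) m ↔ Coloring g (l₁ ++ l₂) m := by
  rw [coloring_capAt_comp]
  constructor
  · rintro ⟨l₁', s', l₂', h, h₁', hg⟩
    obtain ⟨rfl, h'⟩ := List.append_inj h (h₁.trans h₁'.symm)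
    cases h'
    exact hg
  · intro hg
    exact ⟨l₁, s, l₂, rfl, h₁, hg⟩

/-! ### Caps followed by cups -/

/-- Caps followed by an arrow that satisfies `B`. -/
inductive CapsThen (B : ∀ v w, Arrow CapCup v w → Prop) :
    ∀ {v w : List Orient}, Arrow CapCup v w → Prop
  | base {v w v' w' : List Orient} {f : Arrow CapCup v w} {g : Arrow CapCup v' w'} :
      f ≃ₐ g → B v' w' g → CapsThen B f
  | consCap {v w w' : List Orient} {f : Arrow CapCup v w} (a : List Orient) (x : Orient)
      (b : List Orient) {g : Arrow CapCup (a ++ b) w'} :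
      f ≃ₐ (capAt a x b).comp g → CapsThen B g → CapsThen B f

/-- Identities, up to equivalence. -/
def IsId (v w : List Orient) (f : Arrow CapCup v w) : Prop :=
  ∃ u, f ≃ₐ Arrow.id u

/-- Compositions of cups. -/
def IsCups (v w : List Orient) (f : Arrow CapCup v w) : Prop :=
  CapsThen IsId (reflect f)

/-- Compositions of caps followed by compositions of cups. -/
abbrev CapsCups {v w : List Orient} (f : Arrow CapCup v w) : Prop :=
  CapsThen IsCups f

variable {B : ∀ v w, Arrow CapCup v w → Prop}

theorem CapsThen.congr {v w v' w' : List Orient} {f : Arrow CapCup v w}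
    {g : Arrow CapCup v' w'} (hg : CapsThen B g) (h : f ≃ₐ g) : CapsThen B f := by
  cases hg with
  | base h' hB => exact .base (h.trans h') hB
  | consCap a x b h' hg => exact .consCap a x b (h.trans h') hg

theorem CapsThen.comp {u v w : List Orient} {f : Arrow CapCup u v} (hf : CapsThen IsId f)
    {g : Arrow CapCup v w} (hg : CapsThen B g) : CapsThen B (f.comp g) := by
  induction hf with
  | base h hB =>
    obtain ⟨u, hu⟩ := hB
    obtain ⟨rfl, rfl⟩ := (h.trans hu).src_tgt_eq
    exact hg.congr ((ArrowEquiv.comp_congr (h.trans hu) (.refl g)).trans (.id_comp g))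
  | consCap a x b h _ ih =>
    obtain ⟨rfl, rfl⟩ := h.src_tgt_eq
    exact .consCap a x b ((ArrowEquiv.comp_congr h (.refl g)).trans (.assoc _ _ _)) (ih hg)

/-- Every colouring of the source extends. -/
def Free (B : ∀ v w, Arrow CapCup v w → Prop) : Prop :=
  ∀ v w (f : Arrow CapCup v w), B v w f → ∀ l : List Bool, l.length = v.length →
    ∃ m, Coloring f l m

theorem free_isId : Free IsId := by
  rintro v w f ⟨u, h⟩ l hl
  obtain ⟨rfl, rfl⟩ := h.src_tgt_eq
  exact ⟨l, (coloring_congr h _ _).2 ⟨rfl, hl⟩⟩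

theorem CapsThen.exists_coloring {v w : List Orient} {f : Arrow CapCup v w}
    (hf : CapsThen IsId f) (m : List Bool) (hm : m.length = w.length) : ∃ l, Coloring f l m := by
  induction hf with
  | base h hB =>
    obtain ⟨u, hu⟩ := hB
    obtain ⟨rfl, rfl⟩ := (h.trans hu).src_tgt_eq
    exact ⟨m, (coloring_congr (h.trans hu) _ _).2 ⟨rfl, hm⟩⟩
  | consCap a x b h _ ih =>
    obtain ⟨rfl, rfl⟩ := h.src_tgt_eq
    obtain ⟨l, hl⟩ := ih hm
    have hlen := hl.length.1
    rw [List.length_append] at hlen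
    -- The colour `true` of the added cap is arbitrary.
    refine ⟨_, (coloring_congr h _ _).2 ((coloring_capAt_comp _ _ _).2
      ⟨l.take a.length, true, l.drop a.length, rfl, ?_, by simpa using hl⟩)⟩
    simp; omega

/-- By reflection, this is the extension of target colours through a composition of caps. -/
theorem free_isCups : Free IsCups := fun _ _ f hf l hl => by
  obtain ⟨m, h⟩ := CapsThen.exists_coloring hf l hl
  exact ⟨m, (coloring_reflect f _ _).1 h⟩

/-- All colourings of `f` give the same colour to the source places `n` and `n + 1`. -/
def SameColor {v w : List Orient} (f : Arrow CapCup v w) (n : ℕ) : Prop :=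
  ∀ (l₁ l₂ : List Bool) (s t : Bool) (m : List Bool), l₁.length = n →
    Coloring f (l₁ ++ s :: t :: l₂) m → s = t

theorem sameColor_capAt_comp {a b w : List Orient} {x : Orient} (g : Arrow CapCup (a ++ b) w) :
    SameColor ((capAt a x b).comp g) a.length := by
  intro l₁ l₂ s t m hl h
  obtain ⟨l₁', s', l₂', h, hl', -⟩ := (coloring_capAt_comp _ _ _).1 h
  obtain ⟨rfl, h'⟩ := List.append_inj h (hl.trans hl'.symm)
  cases h'
  rfl

theorem SameColor.congr {v w v' w' : List Orient} {f : Arrow CapCup v w}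
    {g : Arrow CapCup v' w'} {n : ℕ} (hg : SameColor g n) (h : f ≃ₐ g) : SameColor f n :=
  fun l₁ l₂ s t m hl hf => hg l₁ l₂ s t m hl ((coloring_congr h _ _).1 hf)

theorem not_sameColor_of_free (hB : Free B) {a b w : List Orient} {x y : Orient}
    {f : Arrow CapCup (a ++ x :: y :: b) w} (hf : B _ _ f) : ¬ SameColor f a.length := by
  intro h
  -- Freeness allows different colours at the two places.
  obtain ⟨m, hm⟩ := hB _ _ f hf (List.replicate a.length true ++ true :: false ::
    List.replicate b.length true) (by simp)
  exact absurd (h _ _ _ _ _ (by simp) hm) (by decide)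

/-- The colour of a cap is independent of that of the strand on its right. -/
theorem not_sameColor_capAt_comp_right {a b w : List Orient} {x z : Orient}
    (g : Arrow CapCup (a ++ z :: b) w) :
    ¬ SameColor ((capAt a x (z :: b)).comp g) (a.length + 1) := by
  intro h
  have hg := coloring_replicate g true
  rw [List.length_append, List.length_cons, List.replicate_add, List.replicate_succ] at hg
  -- Everything is coloured `true` except the cap, which alone is `false`.
  have := (coloring_capAt_comp_insert (x := x) g _ _ _ false (by simp)).2 hg
  rw [show List.replicate a.length true ++ false :: false :: true :: List.replicate b.length true =
    (List.replicate a.length true ++ [false]) ++ false :: true :: List.replicate b.length true by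
      simp] at this
  exact absurd (h _ _ _ _ _ (by simp) this) (by decide)

/-- The colour of a cap is independent of that of the strand on its left. -/
theorem not_sameColor_capAt_comp_left {a b w : List Orient} {x z : Orient}
    (g : Arrow CapCup ((a ++ [z]) ++ b) w) :
    ¬ SameColor ((capAt (a ++ [z]) x b).comp g) a.length := by
  intro h
  have hg := coloring_replicate g true
  rw [List.length_append, List.replicate_add] at hg
  have := (coloring_capAt_comp_insert (x := x) g _ _ _ false (by simp)).2 hg
  exact absurd (h (List.replicate a.length true) (false :: List.replicate b.length true) true false
    _ (by simp) (by simpa [List.replicate_succ'] using this)) (by decide)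

theorem SameColor.of_capAt_comp_right {a b w : List Orient} {x : Orient} {n : ℕ}
    {g : Arrow CapCup (a ++ b) w} (h : SameColor ((capAt a x b).comp g) n)
    (hn : n + 2 ≤ a.length) : SameColor g n := by
  intro l₁ l₂ s t m hl hg
  have hlen := hg.length.1
  simp only [List.length_append, List.length_cons] at hlen
  -- The cap is to be inserted after `a.length` colours, of which `n + 2` are `l₁`, `s` and `t`.
  have hl₂ := List.take_append_drop (a.length - (n + 2)) l₂
  rw [← hl₂, ← List.cons_append, ← List.cons_append, ← List.append_assoc] at hg
  have := (coloring_capAt_comp_insert (x := x) g _ _ _ true (by simp; omega)).2 hg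
  rw [List.append_assoc, List.cons_append, List.cons_append] at this
  exact h _ _ _ _ _ hl this

theorem SameColor.of_capAt_comp_left {a b w : List Orient} {x : Orient} {n : ℕ}
    {g : Arrow CapCup (a ++ b) w} (h : SameColor ((capAt a x b).comp g) (n + 2))
    (hn : a.length ≤ n) : SameColor g n := by
  intro l₁ l₂ s t m hl hg
  rw [← List.take_append_drop a.length l₁, List.append_assoc] at hg
  have := (coloring_capAt_comp_insert (x := x) g _ _ _ true (by simp; omega)).2 hg
  rw [← List.cons_append, ← List.cons_append, ← List.append_assoc] at this
  exact h _ _ _ _ _ (by simp; omega) this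

/-- Two pairs of adjacent places in one word coincide, share a single place (on either side), or are
disjoint (on either side). These cases govern both the comparison of two caps and that of a cup with
a cap. -/
theorem two_pairs_cases {a b a' b' : List Orient} {x x' y y' : Orient}
    (h : a' ++ y :: y' :: b' = a ++ x :: x' :: b) :
    (a' = a ∧ y = x ∧ y' = x' ∧ b' = b) ∨
    (a' = a ++ [x] ∧ y = x' ∧ b = y' :: b') ∨
    (a = a' ++ [y] ∧ x = y' ∧ b' = x' :: b) ∨
    (∃ c, a' = a ++ x :: x' :: c ∧ b = c ++ y :: y' :: b') ∨
    (∃ c, a = a' ++ y :: y' :: c ∧ b' = c ++ x :: x' :: b) := by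
  rw [List.append_eq_append_iff] at h
  rcases h with ⟨c, rfl, h⟩ | ⟨c, rfl, h⟩ <;> rcases c with _ | ⟨c₁, _ | ⟨c₂, c⟩⟩ <;>
    simp_all

/-- Caps can be detected by colours: places that always agree in colour are joined by a cap. This
cap either is the first one, or is disjoint from it and, found by induction in the remaining arrow,
can be exchanged with it. -/
theorem CapsThen.exists_cap (hB : Free B) {v w : List Orient} {f : Arrow CapCup v w}
    (hf : CapsThen B f) : ∀ (a : List Orient) (x : Orient) (b : List Orient),
      v = a ++ x :: x.dual :: b → SameColor f a.length →
      ∃ g : Arrow CapCup (a ++ b) w, f ≃ₐ (capAt a x b).comp g ∧ CapsThen B g := by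
  induction hf with
  | base h hg =>
    rintro a x b rfl hs
    obtain ⟨rfl, rfl⟩ := h.src_tgt_eq
    exact absurd (hs.congr h.symm) (not_sameColor_of_free hB hg)
  | @consCap v w w' f a' y b' g h hg ih =>
    intro a x b hv hs
    obtain rfl := h.tgt_eq
    have hs' := hs.congr h.symm
    have hv' := h.src_eq.symm.trans hv
    rcases two_pairs_cases hv' with ⟨rfl, rfl, -, rfl⟩ | ⟨rfl, -, rfl⟩ | ⟨rfl, -, rfl⟩ |
      ⟨c, rfl, rfl⟩ | ⟨c, rfl, rfl⟩
    · exact ⟨g, h, hg⟩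
    -- In this case and the next, the first cap shares only one place with the pair, so recolouring
    -- it separates the two colours.
    · exact absurd hs' (not_sameColor_capAt_comp_left g)
    · rw [List.length_append, List.length_singleton] at hs'
      exact absurd hs' (not_sameColor_capAt_comp_right g)
    · obtain ⟨g', h', hg'⟩ := ih a x (c ++ b') (by simp) (hs'.of_capAt_comp_right (by simp))
      -- Here and in the mirror case, the arrows obtained are caps and remainders over rebracketed
      -- words, ready for `slice_exchange`.
      obtain ⟨p, hp⟩ := (capAt (a ++ c) y b').exists_equiv
        (by simp : a ++ (c ++ y :: y.dual :: b') = _) (by simp : a ++ (c ++ b') = _)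
      obtain ⟨r, hr⟩ := (capAt a x (c ++ b')).exists_equiv
        (by simp : (a ++ x :: x.dual :: c) ++ b' = _) rfl
      obtain ⟨r', hr'⟩ := (capAt (a ++ x :: x.dual :: c) y b').exists_equiv
        (by simp : a ++ x :: x.dual :: (c ++ y :: y.dual :: b') = _) rfl
      obtain ⟨g₁, hg₁⟩ := g'.exists_equiv (by simp : (a ++ c) ++ b' = _) rfl
      refine ⟨p.comp g', ?_, .consCap _ _ _ (.comp_congr hp hg₁.symm) (hg'.congr hg₁)⟩
      calc _ ≃ₐ r'.comp (r.comp g') :=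
            h.trans (.comp_congr hr'.symm (h'.trans (.comp_congr hr.symm (.refl _))))
        _ ≃ₐ (r'.comp r).comp g' := (ArrowEquiv.assoc _ _ _).symm
        _ ≃ₐ (((capAt a x _).comp p).comp g') :=
          .comp_congr (ArrowEquiv.slice_exchange (f := cap x) (g := cap y) (a := a) (b := b')
            (c := c) (.refl _) hp hr' hr).symm (.refl _)
        _ ≃ₐ _ := .assoc _ _ _
    · obtain ⟨g', h', hg'⟩ := ih (a' ++ c) x b (by simp) (by
        rw [List.length_append] at hs' ⊢
        exact hs'.of_capAt_comp_left (by simp))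
      obtain ⟨p, hp⟩ := (capAt (a' ++ c) x b).exists_equiv
        (by simp : a' ++ (c ++ x :: x.dual :: b) = _) (by simp : a' ++ (c ++ b) = _)
      obtain ⟨r, hr⟩ := (capAt a' y (c ++ b)).exists_equiv
        (by simp : (a' ++ y :: y.dual :: c) ++ b = _) rfl
      obtain ⟨r', hr'⟩ := (capAt (a' ++ y :: y.dual :: c) x b).exists_equiv
        (by simp : a' ++ y :: y.dual :: (c ++ x :: x.dual :: b) = _) rfl
      obtain ⟨g₁, hg₁⟩ := g'.exists_equiv (by simp : a' ++ (c ++ b) = _) rfl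
      refine ⟨r.comp g₁, ?_, .consCap _ _ _ (.comp_congr hr (.refl _)) (hg'.congr hg₁)⟩
      calc _ ≃ₐ (capAt a' y _).comp (p.comp g₁) :=
            h.trans (.comp_congr (.refl _) (h'.trans (.comp_congr hp.symm hg₁.symm)))
        _ ≃ₐ ((capAt a' y _).comp p).comp g₁ := (ArrowEquiv.assoc _ _ _).symm
        _ ≃ₐ (r'.comp r).comp g₁ :=
          .comp_congr (ArrowEquiv.slice_exchange (f := cap y) (g := cap x) (a := a') (b := b)
            (c := c) (.refl _) hp hr' hr) (.refl _)
        _ ≃ₐ _ := (ArrowEquiv.assoc _ _ _).trans (.comp_congr hr' (.refl _))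

/-- Diagrams that satisfy `B` are determined by their colourings. -/
def Faithful (B : ∀ v w, Arrow CapCup v w → Prop) : Prop :=
  ∀ v w (f f' : Arrow CapCup v w), B v w f → B v w f' →
    (∀ l m, Coloring f l m ↔ Coloring f' l m) → f ≃ₐ f'

/-- A first cap of `f` forces equal colours at its legs, hence also in `f'`, which can therefore be
rewritten to begin with the same cap; the remainders again have equal colourings. When `f` has no
cap left, freeness prevents `f'` from having one. -/
theorem faithful_capsThen (hfree : Free B) (hfaith : Faithful B) :
    Faithful fun _ _ f => CapsThen B f := by
  intro v w f f' hf hf' hc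
  induction hf with
  | @base v w v' w' f g h hg =>
    obtain ⟨rfl, rfl⟩ := h.src_tgt_eq
    cases hf' with
    | base h' hg' =>
      obtain ⟨rfl, rfl⟩ := h'.src_tgt_eq
      exact (h.trans (hfaith _ _ _ _ hg hg' fun l m => (coloring_congr h l m).symm.trans
        ((hc l m).trans (coloring_congr h' l m)))).trans h'.symm
    | consCap a x b h' _ =>
      obtain ⟨rfl, rfl⟩ := h'.src_tgt_eq
      refine absurd ?_ (not_sameColor_of_free hfree hg)
      intro l₁ l₂ s t m hl hm
      exact sameColor_capAt_comp _ l₁ l₂ s t m hl ((coloring_congr h' _ _).1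
        ((hc _ _).1 ((coloring_congr h _ _).2 hm)))
  | consCap a x b h hg ih =>
    obtain ⟨rfl, rfl⟩ := h.src_tgt_eq
    obtain ⟨g', h', hg'⟩ := CapsThen.exists_cap hfree hf' a x b rfl (by
      intro l₁ l₂ s t m hl hm
      exact sameColor_capAt_comp _ l₁ l₂ s t m hl ((coloring_congr h _ _).1 ((hc _ _).2 hm)))
    refine h.trans ((ArrowEquiv.comp_congr (.refl _) (ih g' hg' fun l m => ?_)).trans h'.symm)
    have key : ∀ l₁ l₂, l₁.length = a.length →
        (Coloring _ (l₁ ++ l₂) m ↔ Coloring g' (l₁ ++ l₂) m) := fun l₁ l₂ hl =>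
      (coloring_capAt_comp_insert (x := x) _ l₁ l₂ m true hl).symm.trans
        ((coloring_congr h _ _).symm.trans ((hc _ _).trans ((coloring_congr h' _ _).trans
          (coloring_capAt_comp_insert (x := x) g' l₁ l₂ m true hl))))
    -- A shorter list is a colouring of neither side, for reasons of length.
    by_cases hl : a.length ≤ l.length
    · have := key (l.take a.length) (l.drop a.length) (by simpa using hl)
      rwa [List.take_append_drop] at this
    · constructor <;> intro hm <;> have := hm.length.1 <;> rw [List.length_append] at this <;> omega

theorem faithful_isId : Faithful IsId := by
  rintro v w f f' ⟨u, h⟩ ⟨u', h'⟩ -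
  obtain ⟨rfl, rfl⟩ := h.src_tgt_eq
  obtain ⟨rfl, -⟩ := h'.src_tgt_eq
  exact h.trans h'.symm

theorem faithful_isCups : Faithful IsCups := by
  intro v w f f' hf hf' hc
  have := reflect_congr (faithful_capsThen free_isId faithful_isId _ _ _ _ hf hf' fun l m => by
    rw [coloring_reflect, coloring_reflect, hc])
  rwa [reflect_reflect, reflect_reflect] at this

theorem faithful_capsCups : Faithful fun _ _ f => CapsCups f :=
  faithful_capsThen free_isCups faithful_isCups

/-! ### Irreducible diagrams are caps followed by cups -/

section Reduction

variable {k : Type*} [CommRing k] (q : kˣ)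

theorem hasStep_cup_comp_cap (x : Orient) : HasStep (Rule q) ((cup x).comp (cap x)) := by
  cases x
  · exact ⟨_, _, _, _, _, .refl _, .rule .bubbleCounterclockwise⟩
  · exact ⟨_, _, _, _, _, .refl _, .rule .bubbleClockwise⟩

/-- The zigzag made of a cup with a cap on its right. -/
def zigzagRight (x : Orient) : Arrow CapCup [x.dual.dual] [x] :=
  Arrow.comp (v := [x, x.dual, x.dual.dual]) ((cup x).tensor (.id [x.dual.dual]))
    ((Arrow.id [x]).tensor (cap x.dual))

/-- The zigzag made of a cup with a cap on its left. -/
def zigzagLeft (x : Orient) : Arrow CapCup [x] [x.dual.dual] :=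
  Arrow.comp (v := [x, x.dual, x.dual.dual]) ((Arrow.id [x]).tensor (cup x.dual))
    ((cap x).tensor (.id [x.dual.dual]))

theorem hasStep_zigzagRight (x : Orient) : HasStep (Rule q) (zigzagRight x) := by
  -- `x.dual.dual` reduces to `x` only once `x` is a constructor.
  cases x
  · exact ⟨_, _, _, _, _, .refl _, .rule .zigzagDownRight⟩
  · exact ⟨_, _, _, _, _, .refl _, .rule .zigzagUpRight⟩

theorem hasStep_zigzagLeft (x : Orient) : HasStep (Rule q) (zigzagLeft x) := by
  cases x
  · exact ⟨_, _, _, _, _, .refl _, .rule .zigzagDownLeft⟩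
  · exact ⟨_, _, _, _, _, .refl _, .rule .zigzagUpLeft⟩

/-- Either a rule applies to `f`, or `f` consists of caps followed by cups. -/
def Sorted {v w : List Orient} (f : Arrow CapCup v w) : Prop :=
  HasStep (Rule q) f ∨ CapsCups f

variable {q}

theorem Sorted.congr {v w v' w' : List Orient} {f : Arrow CapCup v w} {g : Arrow CapCup v' w'}
    (hg : Sorted q g) (h : f ≃ₐ g) : Sorted q f :=
  hg.imp (HasStep.congr · h) (CapsThen.congr · h)

theorem Sorted.capAt_comp {u v w : List Orient} {p : Arrow CapCup u v} {a b : List Orient}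
    {x : Orient} (hp : p ≃ₐ capAt a x b) {g : Arrow CapCup v w} (hg : Sorted q g) :
    Sorted q (p.comp g) := by
  obtain ⟨rfl, rfl⟩ := hp.src_tgt_eq
  exact hg.imp (HasStep.comp_left p) (CapsThen.consCap a x b (.comp_congr hp (.refl g)))

/-- The cup is pushed through the caps one at a time. A cap on the same two strands makes a bubble,
a cap on one of them makes a zigzag, and a disjoint cap is exchanged with the cup, which then meets
the shorter remainder. -/
theorem CapsThen.cupAt_comp {v w : List Orient} {g : Arrow CapCup v w} (hg : CapsCups g) :
    ∀ {u : List Orient} (p : Arrow CapCup u v) (a : List Orient) (x : Orient) (b : List Orient),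
      p ≃ₐ cupAt a x b → Sorted q (p.comp g) := by
  induction hg with
  | @base v w _ _ g g₁ h hg₁ =>
    intro u p a x b hp
    obtain ⟨rfl, rfl⟩ := h.src_tgt_eq
    -- No cap is left: in the reflection, the cup becomes one more cap at the end.
    refine .inr (.base (.comp_congr (.refl p) h) ?_)
    have hp' := reflect_congr hp
    rw [reflect_cupAt] at hp'
    obtain ⟨hv, rfl⟩ := hp'.src_tgt_eq
    exact CapsThen.comp hg₁ (.consCap a x b (hp'.trans (ArrowEquiv.comp_id _).symm)
      (.base (.refl _) ⟨_, .refl _⟩))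
  | @consCap v w w' f a' y b' g h hg ih =>
    intro u p a x b hp
    obtain ⟨rfl, rfl⟩ := h.src_tgt_eq
    have hv := hp.tgt_eq
    have h₁ : p.comp f ≃ₐ (p.comp (capAt a' y b')).comp g :=
      (ArrowEquiv.comp_congr (.refl p) h).trans (ArrowEquiv.assoc _ _ _).symm
    have hstep : HasStep (Rule q) (p.comp (capAt a' y b')) → Sorted q (p.comp f) :=
      fun hs => .inl ((hs.comp_right g).congr h₁)
    rcases two_pairs_cases hv with ⟨rfl, rfl, -, rfl⟩ | ⟨rfl, rfl, rfl⟩ | ⟨rfl, rfl, rfl⟩ |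
      ⟨c, rfl, rfl⟩ | ⟨c, rfl, rfl⟩
    · exact hstep (((hasStep_cup_comp_cap q y).slice a' b').congr
        ((ArrowEquiv.comp_congr hp (.refl _)).trans (ArrowEquiv.slice_comp _ _ _ _).symm))
    · exact hstep (((hasStep_zigzagRight q x).slice a b').congr
        ((ArrowEquiv.comp_congr (hp.trans
          (ArrowEquiv.tensor_id_slice (cup x) a b' [x.dual.dual]).symm)
          (ArrowEquiv.id_tensor_slice (cap x.dual) a b' [x]).symm).trans
            (ArrowEquiv.slice_comp _ _ _ _).symm))
    · exact hstep (((hasStep_zigzagLeft q y).slice a' b).congr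
        ((ArrowEquiv.comp_congr (hp.trans (ArrowEquiv.id_tensor_slice (cup y.dual) a' b [y]).symm)
          (ArrowEquiv.tensor_id_slice (cap y) a' b [y.dual.dual]).symm).trans
            (ArrowEquiv.slice_comp _ _ _ _).symm))
    · obtain ⟨p', hp'⟩ := (cupAt a x (c ++ b')).exists_equiv rfl
        (by simp : (a ++ x :: x.dual :: c) ++ b' = _)
      obtain ⟨r, hr⟩ := (capAt (a ++ c) y b').exists_equiv
        (by simp [hp.src_eq] : u = _) (by simp : a ++ (c ++ b') = _)
      refine ((ih p' a x _ hp').capAt_comp hr).congr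
        (h₁.trans ((ArrowEquiv.comp_congr ?_ (.refl g)).trans (.assoc _ _ _)))
      exact ArrowEquiv.slice_exchange (f := cup x) (g := cap y) (a := a) (b := b')
        (c := c) hp (.refl _) hr hp'
    · obtain ⟨p', hp'⟩ := (cupAt (a' ++ c) x b).exists_equiv
        (by simp : a' ++ (c ++ b) = _) (by simp : a' ++ (c ++ x :: x.dual :: b) = _)
      obtain ⟨r, hr⟩ := (capAt a' y (c ++ b)).exists_equiv
        (by simp [hp.src_eq] : u = _) rfl
      refine ((ih p' _ x _ hp').capAt_comp hr).congr
        (h₁.trans ((ArrowEquiv.comp_congr ?_ (.refl g)).trans (.assoc _ _ _)))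
      exact (ArrowEquiv.slice_exchange (f := cap y) (g := cup x) (a := a') (b := b)
        (c := c) hr hp' hp (.refl _)).symm

theorem Sorted.cupAt_comp {u v w : List Orient} {p : Arrow CapCup u v} {a b : List Orient}
    {x : Orient} (hp : p ≃ₐ cupAt a x b) {g : Arrow CapCup v w} (hg : Sorted q g) :
    Sorted q (p.comp g) :=
  hg.elim (fun h => .inl (h.comp_left p)) (fun h => h.cupAt_comp p a x b hp)

/-- Generators are prepended one by one to a sorted arrow. The identities on both sides are
arbitrary so that the induction passes through tensor products. -/
theorem Sorted.slice_comp {v w : List Orient} (f : Arrow CapCup v w) :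
    ∀ (a b : List Orient) {x : List Orient} {g : Arrow CapCup (a ++ (w ++ b)) x},
      Sorted q g → Sorted q ((f.slice a b).comp g) := by
  induction f with
  | gen f =>
    intro a b x g hg
    cases f
    · exact hg.capAt_comp (x := down) (.refl _)
    · exact hg.capAt_comp (x := up) (.refl _)
    · exact hg.cupAt_comp (x := down) (.refl _)
    · exact hg.cupAt_comp (x := up) (.refl _)
  | id v =>
    intro a b x g hg
    exact hg.congr ((ArrowEquiv.comp_congr (ArrowEquiv.slice_id a v b) (.refl g)).trans
      (.id_comp g))
  | comp f f' hf hf' =>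
    intro a b x g hg
    exact (hf a b (hf' a b hg)).congr
      ((ArrowEquiv.comp_congr (ArrowEquiv.slice_comp f f' a b) (.refl g)).trans (.assoc _ _ _))
  | @tensor v w v' w' f f' hf hf' =>
    intro a b x g hg
    -- The tensor product is `f ⊗ 1` followed by `1 ⊗ f'`, so `f'` is prepended before `f`.
    obtain ⟨g₁, hg₁⟩ := g.exists_equiv (by simp : (a ++ w) ++ (w' ++ b) = _) rfl
    obtain ⟨g₂, hg₂⟩ := ((f'.slice (a ++ w) b).comp g₁).exists_equiv
      (by simp : a ++ (w ++ (v' ++ b)) = _) rfl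
    refine (hf a (v' ++ b) ((hf' (a ++ w) b (hg.congr hg₁)).congr hg₂)).congr ?_
    calc _ ≃ₐ (((f.tensor (Arrow.id v')).comp ((Arrow.id w).tensor f')).slice a b).comp g :=
          .comp_congr (ArrowEquiv.slice_congr a b (ArrowEquiv.tensor_left_right f f')) (.refl g)
      _ ≃ₐ (((f.tensor (Arrow.id v')).slice a b).comp
          (((Arrow.id w).tensor f').slice a b)).comp g :=
          .comp_congr (ArrowEquiv.slice_comp _ _ a b) (.refl g)
      _ ≃ₐ ((f.tensor (Arrow.id v')).slice a b).comp
          ((((Arrow.id w).tensor f').slice a b).comp g) :=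
          .assoc _ _ _
      _ ≃ₐ _ := .comp_congr (ArrowEquiv.tensor_id_slice f a b v')
          ((ArrowEquiv.comp_congr (ArrowEquiv.id_tensor_slice f' a b w) hg₁.symm).trans hg₂.symm)

theorem sorted_id (v : List Orient) : Sorted q (Arrow.id v) :=
  .inr (.base (.refl _) (CapsThen.base (.refl _) ⟨v, .refl _⟩))

theorem sorted {v w : List Orient} (f : Arrow CapCup v w) : Sorted q f := by
  obtain ⟨g, hg⟩ := (Arrow.id (F := CapCup) w).exists_equiv (by simp : [] ++ (w ++ []) = w) rfl
  exact (Sorted.slice_comp f [] [] ((sorted_id w).congr hg)).congr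
    ((ArrowEquiv.comp_id f).symm.trans
      (.comp_congr (ArrowEquiv.slice_nil f).symm hg.symm))

theorem capsCups_of_isNormalForm {v w : List Orient} {f : Arrow CapCup v w}
    (h : IsNormalForm (Rule q) (Diagram.mk f)) : CapsCups f :=
  (sorted f).resolve_left h.not_hasStep

end Reduction

/-! ### Invariants of rewriting steps -/

/-- The sum of the weights of the generators. -/
def weight {A : Type} [AddCommMonoid A] (φ : ∀ {v w}, CapCup v w → A) :
    ∀ {v w : List Orient}, Arrow CapCup v w → A
  | _, _, .gen g => φ g
  | _, _, .id _ => 0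
  | _, _, .comp f g => weight φ f + weight φ g
  | _, _, .tensor f g => weight φ f + weight φ g

/-- Commutativity of the addition is what the exchange law requires. -/
theorem weight_congr {A : Type} [AddCommMonoid A] (φ : ∀ {v w}, CapCup v w → A)
    {v w v' w' : List Orient} {f : Arrow CapCup v w} {g : Arrow CapCup v' w'} (h : f ≃ₐ g) :
    weight φ f = weight φ g := by
  induction h with
  | refl f => rfl
  | symm _ ih => exact ih.symm
  | trans _ _ ih ih' => exact ih.trans ih'
  | comp_congr _ _ ih ih' => simp only [weight, ih, ih']
  | tensor_congr _ _ ih ih' => simp only [weight, ih, ih']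
  | id_comp f => simp only [weight, zero_add]
  | comp_id f => simp only [weight, add_zero]
  | assoc f g h => simp only [weight, add_assoc]
  | id_tensor f => simp only [weight, zero_add]
  | tensor_id f => simp only [weight, add_zero]
  | tensor_assoc f g h => simp only [weight, add_assoc]
  | id_tensor_id v w => simp only [weight, zero_add]
  | exchange f f' g g' => simp only [weight]; exact add_add_add_comm _ _ _ _

/-- The number of generators. -/
def size {v w : List Orient} (D : Diagram CapCup v w) : ℕ :=
  Quotient.lift (weight fun {_ _} _ => 1) (fun _ _ h => weight_congr _ h) D

/-- A weight of generators that vanishes on zigzags and is `±1` on bubbles. -/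
def CapCup.turn : ∀ {v w : List Orient}, CapCup v w → ℤ
  | _, _, .capPlus => 0
  | _, _, .capMinus => -1
  | _, _, .cupPlus => 1
  | _, _, .cupMinus => 0

/-- The total turning of a diagram. -/
def turn {v w : List Orient} (D : Diagram CapCup v w) : ℤ :=
  Quotient.lift (weight CapCup.turn) (fun _ _ h => weight_congr _ h) D

/-- The colourings of a diagram. -/
def colorings {v w : List Orient} (D : Diagram CapCup v w) : List Bool → List Bool → Prop :=
  Quotient.lift (fun f : Arrow CapCup v w => Coloring f)
    (fun _ _ h => funext₂ fun l m => propext (coloring_congr h l m)) D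

/-! ### Effect of a rewriting step on size, turning and colourings -/

variable {k : Type*} [CommRing k] {q : kˣ}

theorem size_of_step {v w : List Orient} {D D' : Diagram CapCup v w} {c : k}
    (h : DiagramStep (Rule q) D c D') : size D' < size D := by
  obtain ⟨f, f', rfl, rfl, h⟩ := h
  change weight (fun {_ _} _ => 1) f' < weight (fun {_ _} _ => 1) f
  induction h with
  | rule h => cases h <;> simp [weight]
  | _ => simp only [weight]; omega

theorem turn_of_step {v w : List Orient} {D D' : Diagram CapCup v w} {c : k}
    (h : DiagramStep (Rule q) D c D') :
    ((q ^ turn D : kˣ) : k) = c * ((q ^ turn D' : kˣ) : k) := by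
  obtain ⟨f, f', rfl, rfl, h⟩ := h
  change ((q ^ weight CapCup.turn f : kˣ) : k) = c * ((q ^ weight CapCup.turn f' : kˣ) : k)
  induction h with
  | rule h => cases h <;> simp [weight, CapCup.turn]
  | comp_right g _ ih => simp only [weight, zpow_add, Units.val_mul, ih, mul_assoc]
  | tensor_right g _ ih => simp only [weight, zpow_add, Units.val_mul, ih, mul_assoc]
  | comp_left f _ ih => simp only [weight, zpow_add, Units.val_mul, ih, mul_left_comm]
  | tensor_left f _ ih => simp only [weight, zpow_add, Units.val_mul, ih, mul_left_comm]

/-- Only the existence of an extension is recorded, not the number of extensions, so a closed loop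
contributes nothing. -/
theorem coloring_bubble (x : Orient) (l m : List Bool) :
    Coloring ((cup x).comp (cap x)) l m ↔ Coloring (Arrow.id []) l m := by
  cases x <;> simp only [cup, cap, Coloring, CapCup.Coloring] <;> constructor <;>
    first
    | (rintro ⟨_, ⟨rfl, s, rfl⟩, t, -, rfl⟩; exact ⟨rfl, rfl⟩)
    | (rintro ⟨rfl, h⟩
       obtain rfl := List.length_eq_zero_iff.1 h
       exact ⟨_, ⟨rfl, true, rfl⟩, true, rfl, rfl⟩)

theorem coloring_zigzagRight (x : Orient) (l m : List Bool) :
    Coloring (zigzagRight x) l m ↔ l = m ∧ l.length = 1 := by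
  cases x <;> simp only [zigzagRight, cup, cap, dual, Coloring, CapCup.Coloring] <;> constructor <;>
    first
    | (rintro ⟨_, ⟨_, l₁, _, _, rfl, rfl, ⟨rfl, s, rfl⟩, rfl, h⟩, m₁, _, _, _, h', rfl, ⟨rfl, h₁⟩,
        t, rfl, rfl⟩
       obtain ⟨y, rfl⟩ := List.length_eq_one_iff.1 h
       obtain ⟨z, rfl⟩ := List.length_eq_one_iff.1 h₁
       simp only [List.nil_append, List.cons_append, List.cons.injEq, and_true] at h'
       grind)
    | (rintro ⟨rfl, h⟩
       obtain ⟨y, rfl⟩ := List.length_eq_one_iff.1 h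
       exact ⟨[y, y, y], ⟨[], [y], [y, y], [y], rfl, rfl, ⟨rfl, y, rfl⟩, rfl, rfl⟩,
        [y], [y, y], [y], [], rfl, rfl, ⟨rfl, rfl⟩, y, rfl, rfl⟩)

theorem coloring_zigzagLeft (x : Orient) (l m : List Bool) :
    Coloring (zigzagLeft x) l m ↔ l = m ∧ l.length = 1 := by
  cases x <;> simp only [zigzagLeft, cup, cap, dual, Coloring, CapCup.Coloring] <;> constructor <;>
    first
    | (rintro ⟨_, ⟨l₁, _, _, _, rfl, rfl, ⟨rfl, h⟩, rfl, s, rfl⟩, _, m₁, _, _, h', rfl,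
        ⟨t, rfl, rfl⟩, rfl, h₁⟩
       obtain ⟨y, rfl⟩ := List.length_eq_one_iff.1 h
       obtain ⟨z, rfl⟩ := List.length_eq_one_iff.1 h₁
       simp only [List.nil_append, List.cons_append, List.cons.injEq, and_true] at h'
       grind)
    | (rintro ⟨rfl, h⟩
       obtain ⟨y, rfl⟩ := List.length_eq_one_iff.1 h
       exact ⟨[y, y, y], ⟨[y], [], [y], [y, y], rfl, rfl, ⟨rfl, rfl⟩, rfl, y, rfl⟩,
        [y, y], [y], [], [y], rfl, rfl, ⟨y, rfl, rfl⟩, rfl, rfl⟩)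

theorem colorings_of_step {v w : List Orient} {D D' : Diagram CapCup v w} {c : k}
    (h : DiagramStep (Rule q) D c D') : colorings D = colorings D' := by
  obtain ⟨f, f', rfl, rfl, h⟩ := h
  refine funext₂ fun l m => propext ?_
  change Coloring f l m ↔ Coloring f' l m
  induction h generalizing l m with
  | rule h =>
    cases h
    · exact coloring_zigzagLeft up l m
    · exact coloring_zigzagRight up l m
    · exact coloring_zigzagLeft down l m
    · exact coloring_zigzagRight down l m
    · exact coloring_bubble down l m
    · exact coloring_bubble up l m
  | _ => simp only [Coloring, *]

theorem eq_of_colorings_eq {v w : List Orient} {D D' : Diagram CapCup v w}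
    (hD : IsNormalForm (Rule q) D) (hD' : IsNormalForm (Rule q) D')
    (h : colorings D = colorings D') : D = D' := by
  induction D, D' using Quotient.inductionOn₂ with
  | h f f' =>
    exact Quotient.sound (faithful_capsCups _ _ _ _ (capsCups_of_isNormalForm hD)
      (capsCups_of_isNormalForm hD') fun l m => iff_of_eq (congrFun₂ h l m))

end OrientedTL

namespace StrictMon

/-! ### Convergence and bases from invariants of diagrams -/

/-- Invariants that witness convergence: `size` decreases, `scalar` records the coefficients of
the rules, and `invariant` separates normal forms. -/
structure Invariants {S : Type} {F : List S → List S → Type} {k : Type*} [CommRing k]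
    (R : Rules k F) (v w : List S) where
  /-- A size that decreases. -/
  size : Diagram F v w → ℕ
  /-- A unit that keeps track of coefficients. -/
  scalar : Diagram F v w → kˣ
  /-- The type of values of the separating invariant. -/
  Value : Type
  /-- The separating invariant. -/
  invariant : Diagram F v w → Value
  size_lt : ∀ {D D' c}, DiagramStep R D c D' → size D' < size D
  scalar_eq : ∀ {D D' c}, DiagramStep R D c D' → (scalar D : k) = c * scalar D'
  invariant_eq : ∀ {D D' c}, DiagramStep R D c D' → invariant D = invariant D'
  separates : ∀ {D D'}, IsNormalForm R D → IsNormalForm R D' → invariant D = invariant D' → D = D'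

namespace Invariants

variable {S : Type} {F : List S → List S → Type} {k : Type*} [CommRing k] {R : Rules k F}
  {v w : List S} (I : Invariants R v w)

/-! ### Normal forms of diagrams and of linear combinations -/

theorem exists_normalForm (I : Invariants R v w) (D : Diagram F v w) :
    ∃ N, IsNormalForm R N ∧ Relation.ReflTransGen (fun D D' => ∃ c, DiagramStep R D c D') D N := by
  induction h : I.size D using Nat.strong_induction_on generalizing D with
  | _ n ih =>
    by_cases hD : IsNormalForm R D
    · exact ⟨D, hD, .refl⟩
    · simp only [IsNormalForm, not_forall, not_not] at hD
      obtain ⟨c, D', hs⟩ := hD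
      obtain ⟨N, hN, hr⟩ := ih _ (h ▸ I.size_lt hs) D' rfl
      exact ⟨N, hN, hr.head ⟨c, hs⟩⟩

/-- The normal form of a diagram. -/
noncomputable def nf (D : Diagram F v w) : Diagram F v w :=
  (I.exists_normalForm D).choose

theorem isNormalForm_nf (D : Diagram F v w) : IsNormalForm R (I.nf D) :=
  (I.exists_normalForm D).choose_spec.1

theorem reduces_nf (D : Diagram F v w) :
    Relation.ReflTransGen (fun D D' => ∃ c, DiagramStep R D c D') D (I.nf D) :=
  (I.exists_normalForm D).choose_spec.2

theorem invariant_nf (D : Diagram F v w) : I.invariant (I.nf D) = I.invariant D := by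
  have h := I.reduces_nf D
  generalize I.nf D = N at h ⊢
  induction h using Relation.ReflTransGen.head_induction_on with
  | refl => rfl
  | head h _ ih => obtain ⟨c, h⟩ := h; rw [ih, I.invariant_eq h]

/-- Both normal forms inherit the same invariant, and it separates normal forms; this stands in for
local confluence. -/
theorem nf_eq_of_step {D D' : Diagram F v w} {c : k} (h : DiagramStep R D c D') :
    I.nf D = I.nf D' :=
  I.separates (I.isNormalForm_nf D) (I.isNormalForm_nf D') (by
    rw [I.invariant_nf, I.invariant_nf, I.invariant_eq h])

theorem nf_eq_self {D : Diagram F v w} (h : IsNormalForm R D) : I.nf D = D :=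
  I.separates (I.isNormalForm_nf D) h (I.invariant_nf D)

/-- The normal form of a linear combination of diagrams. -/
noncomputable def nfMap :
    (Diagram F v w →₀ k) →ₗ[k] ({D : Diagram F v w // IsNormalForm R D} →₀ k) :=
  -- By `scalar_eq`, the quotient of scalars is the product of the coefficients along any reduction
  -- from `D` to `I.nf D`.
  Finsupp.linearCombination k fun D =>
    Finsupp.single ⟨I.nf D, I.isNormalForm_nf D⟩ ((I.scalar D * (I.scalar (I.nf D))⁻¹ : kˣ) : k)

theorem nfMap_single (D : Diagram F v w) (a : k) : I.nfMap (Finsupp.single D a) =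
    Finsupp.single ⟨I.nf D, I.isNormalForm_nf D⟩
      (a * (I.scalar D * (I.scalar (I.nf D))⁻¹ : kˣ)) := by
  rw [nfMap, Finsupp.linearCombination_single, Finsupp.smul_single, smul_eq_mul]

theorem nfMap_single_of_step {D D' : Diagram F v w} {c : k} (h : DiagramStep R D c D') (a : k) :
    I.nfMap (Finsupp.single D a) = I.nfMap (Finsupp.single D' (a * c)) := by
  rw [nfMap_single, nfMap_single]
  congr 1
  · exact Subtype.ext (I.nf_eq_of_step h)
  · rw [I.nf_eq_of_step h, Units.val_mul, Units.val_mul, I.scalar_eq h]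
    ring

theorem nfMap_single_normalForm (D : {D : Diagram F v w // IsNormalForm R D}) (a : k) :
    I.nfMap (Finsupp.single D.1 a) = Finsupp.single D a := by
  rw [nfMap_single]
  congr 1
  · exact Subtype.ext (I.nf_eq_self D.2)
  · rw [I.nf_eq_self D.2]
    simp

theorem mapDomain_nfMap {x : Diagram F v w →₀ k} (h : ∀ D ∈ x.support, IsNormalForm R D) :
    Finsupp.mapDomain Subtype.val (I.nfMap x) = x := by
  have hx : x = ∑ D ∈ x.support, Finsupp.single D (x D) := (Finsupp.sum_single x).symm
  conv_lhs => rw [hx]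
  conv_rhs => rw [hx]
  rw [map_sum, Finsupp.mapDomain_finsetSum]
  refine Finset.sum_congr rfl fun D hD => ?_
  rw [I.nfMap_single_normalForm ⟨D, h D hD⟩, Finsupp.mapDomain_single]

/-- A measure of linear combinations that decreases. -/
noncomputable def measure (x : Diagram F v w →₀ k) : ℕ :=
  ∑ D ∈ x.support, (I.size D + 1)

/-- A plain sum over the support suffices because a rule replaces one diagram by a multiple of a
single smaller one. -/
theorem measure_lt {x y : Diagram F v w →₀ k} (h : LinearStep R v w x y) :
    I.measure y < I.measure x := by
  classical
  obtain ⟨D, D', c, a, z, h, ha, hz, rfl, rfl⟩ := h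
  have hz' : D ∉ z.support := by simpa using hz
  have hx : I.measure (Finsupp.single D a + z) = (I.size D + 1) + I.measure z := by
    rw [measure, Finsupp.support_single_add hz' ha, Finset.sum_cons, measure]
  -- Only an inequality: `D'` may already occur in `z`, and coefficients may vanish or cancel.
  have hy : I.measure (Finsupp.single D' (a * c) + z) ≤ (I.size D' + 1) + I.measure z := by
    refine (Finset.sum_le_sum_of_subset (Finsupp.support_add.trans
      (Finset.union_subset_union_left Finsupp.support_single_subset))).trans ?_
    refine (Nat.le_of_add_right_le (Finset.sum_union_inter).le).trans ?_
    rw [Finset.sum_singleton, measure]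
  have := I.size_lt h
  omega

theorem nfMap_eq_of_linearStep {x y : Diagram F v w →₀ k} (h : LinearStep R v w x y) :
    I.nfMap x = I.nfMap y := by
  obtain ⟨D, D', c, a, z, h, -, -, rfl, rfl⟩ := h
  rw [map_add, map_add, I.nfMap_single_of_step h]

theorem reduces_mapDomain_nfMap (x : Diagram F v w →₀ k) :
    Relation.ReflTransGen (LinearStep R v w) x (Finsupp.mapDomain Subtype.val (I.nfMap x)) := by
  induction h : I.measure x using Nat.strong_induction_on generalizing x with
  | _ n ih =>
    by_cases hx : ∀ D ∈ x.support, IsNormalForm R D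
    · rw [I.mapDomain_nfMap hx]
    · simp only [IsNormalForm, not_forall, not_not] at hx
      obtain ⟨D, hD, c, D', hs⟩ := hx
      -- The whole coefficient of `D` is moved, so that `D` does not occur in the remainder.
      have hstep : LinearStep R v w x (Finsupp.single D' (x D * c) + x.erase D) :=
        ⟨D, D', c, x D, x.erase D, hs, by simpa using hD, by simp,
          (Finsupp.single_add_erase D x).symm, rfl⟩
      have := ih _ (h ▸ I.measure_lt hstep) _ rfl
      rw [← I.nfMap_eq_of_linearStep hstep] at this
      exact this.head hstep

/-- Two results of rewriting the same element have the same image under `nfMap`, and each of them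
rewrites as that image. -/
theorem convergent (I : Invariants R v w) : ARS.Convergent (LinearStep R v w) := by
  constructor
  · intro s hs
    exact (RelEmbedding.not_wellFounded (RelEmbedding.natGT (r := fun m n : ℕ => m < n)
      (fun n => I.measure (s n)) fun n => I.measure_lt (hs n))) wellFounded_lt
  · have key : ∀ {x y}, Relation.ReflTransGen (LinearStep R v w) x y → I.nfMap x = I.nfMap y := by
      intro x y h
      induction h with
      | refl => rfl
      | tail _ h ih => exact ih.trans (I.nfMap_eq_of_linearStep h)
    intro x y z hy hz
    refine ⟨_, I.reduces_mapDomain_nfMap y, ?_⟩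
    rw [← key hy, key hz]
    exact I.reduces_mapDomain_nfMap z

/-! ### Coordinates on the presented category -/

theorem relationIdeal_le_ker : relationIdeal R v w ≤ LinearMap.ker I.nfMap := by
  refine Submodule.span_le.2 ?_
  rintro _ ⟨D, D', c, h, rfl⟩
  rw [SetLike.mem_coe, LinearMap.mem_ker, map_sub, I.nfMap_single_of_step h, one_mul, sub_self]

/-- Each step is an equality in the quotient, and the coefficients multiply to the quotient of
scalars. Hence the normal forms span. -/
theorem ofDiagram_eq_smul_nf (D : Diagram F v w) :
    LinHom.ofDiagram R D =
      ((I.scalar D * (I.scalar (I.nf D))⁻¹ : kˣ) : k) • LinHom.ofDiagram R (I.nf D) := by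
  have h := I.reduces_nf D
  generalize I.nf D = N at h ⊢
  induction h using Relation.ReflTransGen.head_induction_on with
  | refl => simp
  | @head D D' h _ ih =>
    obtain ⟨c, h⟩ := h
    have h₁ : LinHom.ofDiagram R D = c • LinHom.ofDiagram R D' := by
      have hmem : Finsupp.single D 1 - Finsupp.single D' c ∈ relationIdeal R v w :=
        Submodule.subset_span ⟨D, D', c, h, rfl⟩
      refine ((Submodule.Quotient.eq _).2 hmem).trans ?_
      rw [← Finsupp.smul_single_one]
      rfl
    rw [h₁, ih, smul_smul, Units.val_mul, Units.val_mul, I.scalar_eq h, mul_assoc]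

/-- The normal form of an arrow of the presented category. -/
noncomputable def coordinateMap :
    LinHom R v w →ₗ[k] ({D : Diagram F v w // IsNormalForm R D} →₀ k) :=
  (relationIdeal R v w).liftQ I.nfMap I.relationIdeal_le_ker

theorem coordinateMap_ofDiagram (D : Diagram F v w) :
    I.coordinateMap (LinHom.ofDiagram R D) = I.nfMap (Finsupp.single D 1) := rfl

/-- Coordinates with respect to the normal forms. -/
noncomputable def coordinates :
    LinHom R v w ≃ₗ[k] ({D : Diagram F v w // IsNormalForm R D} →₀ k) :=
  LinearEquiv.ofLinearMap I.coordinateMap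
    (Finsupp.linearCombination k fun D => LinHom.ofDiagram R D.1)
    (by
      refine Finsupp.lhom_ext' fun D => LinearMap.ext_ring ?_
      rw [LinearMap.comp_apply, LinearMap.comp_apply, Finsupp.lsingle_apply,
        Finsupp.linearCombination_single, one_smul, coordinateMap_ofDiagram,
        I.nfMap_single_normalForm]
      rfl)
    (by
      refine LinearMap.ext fun x => ?_
      induction x using LinHom.induction with
      | h0 => rw [map_zero, map_zero]
      | hadd x y hx hy => rw [map_add, map_add, hx, hy]
      | hsmul a x hx => rw [map_smul, map_smul, hx]
      | hD D =>
        rw [LinearMap.comp_apply, coordinateMap_ofDiagram, nfMap_single,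
          Finsupp.linearCombination_single, one_mul]
        exact (I.ofDiagram_eq_smul_nf D).symm)

theorem coordinates_symm_single (D : {D : Diagram F v w // IsNormalForm R D}) :
    I.coordinates.symm (Finsupp.single D 1) = LinHom.ofDiagram R D.1 := by
  change Finsupp.linearCombination k _ (Finsupp.single D 1) = _
  rw [Finsupp.linearCombination_single, one_smul]

end Invariants

end StrictMon

/-! ### The oriented Temperley–Lieb case and the conclusion -/

namespace OrientedTL

open StrictMon Orient

/-- The size, the turning and the colourings of oriented Temperley–Lieb diagrams. -/
noncomputable def invariants {k : Type*} [CommRing k] (q : kˣ) (v w : List Orient) :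
    Invariants (Rule q) v w where
  size := size
  scalar D := q ^ turn D
  Value := List Bool → List Bool → Prop
  invariant := colorings
  size_lt := size_of_step
  scalar_eq := turn_of_step
  invariant_eq := colorings_of_step
  separates := eq_of_colorings_eq

end OrientedTL

theorem mainTheorem6 {k : Type*} [CommRing k] (q : kˣ) :
    (∀ v w : List OrientedTL.Orient,
      ARS.Convergent (StrictMon.LinearStep (OrientedTL.Rule q) v w)) ∧
    ∀ v w : List OrientedTL.Orient,
      ∃ b : Module.Basis
          {D : StrictMon.Diagram OrientedTL.CapCup v w //
            StrictMon.IsNormalForm (OrientedTL.Rule q) D} k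
          ((⟨v⟩ : OrientedTL.TLO q) ⟶ ⟨w⟩),
        ∀ D, b D = StrictMon.Presented.ofDiagram (OrientedTL.Rule q) D.1 :=
  ⟨fun v w => (OrientedTL.invariants q v w).convergent, fun v w =>
    ⟨.ofRepr (OrientedTL.invariants q v w).coordinates,
      (OrientedTL.invariants q v w).coordinates_symm_single⟩⟩
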